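/- Let $T=\mathbb{C}/\Lambda$ be a flat torus, $\Lambda\subset\mathbb{C}$ a lattice of rank two. Let $\Gamma$ be a finite bipartite graph (each edge joins a white vertex to a black vertex; multiple edges are allowed) without univalent vertices, embedded in $T$ in such a way that every edge is a straight (geodesic) segment and every face, i.e. every connected component of $T\setminus\Gamma$, is contractible. Let $\Gamma$ be endowed with a perfect orientation, i.e. an orientation of its edges such that every white vertex has exactly one incoming edge and every black vertex has exactly one outgoing edge. For an edge $e$ oriented from white to black, let $e_-$ be the unique edge coming into its white end and $e_+$ the unique edge going out of its black end, let $\alpha_-,\alpha_+\in(-\pi,\pi)$ be the signed angles from the vector $e_-$ to the vector $e$ and from $e$ to $e_+$ respectively, and let $$\mathrm{turn}(e)=\exp\left(\tfrac{\mathrm{i}}{2}(\alpha_-+\alpha_+)\right).$$ Put $k(e)=\mathrm{turn}(e)$ if $e$ is oriented from white to black, and $k(e)=-1$ if $e$ is oriented from black to white. Then $k$ is a fractional Kasteleyn marking, that is: 1. $k(e)\neq 0$ for every edge $e$; 2. for every face $f$, the alternating product of $k$ around $f$ is equal to $(-1)^{l(f)/2+1}$, where $l(f)$ is the (even) number of vertices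 of $f$; 3. the alternating product of $k$ along every cycle (closed walk) of $\Gamma$ is $1$ or $-1$. Here the alternating product along a closed walk is the product of $k(e)$ over the edges traversed from white to black times the product of $k(e)^{-1}$ over the edges traversed from black to white. If the boundary of $f$ is not an embedded polygon, the vertices and edges of $f$ are counted with multiplicity, i.e. as those of the polygon whose image under a cellular map is the closure of $f$. -/

import Mathlib

open Complex Set Filter Topology

noncomputable section

/-- The flat torus `ℂ / Λ`, where `Λ` is a lattice in the Euclidean plane `ℂ`. -/
abbrev FlatTorus (Λ : Submodule ℤ ℂ) : Type := ℂ ⧸ Λ.toAddSubgroup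

/-- A bipartite multigraph with white vertices `W`, black vertices `B` and edges `E`, mapped to
the flat torus `ℂ / Λ` so that every edge is a straight (geodesic) segment. The complex number
`vec e` is the developed displacement along `e`, from its white end to its black end. No
embeddedness is required here; see `StraightGraph.IsToric`. -/
structure StraightGraph (Λ : Submodule ℤ ℂ) (W B E : Type*) where
  /-- the white end of an edge -/
  white : E → W
  /-- the black end of an edge -/
  black : E → B
  /-- the position of the vertices on the torus -/
  pos : W ⊕ B → FlatTorus Λ
  /-- the displacement vector of an edge, from white to black -/
  vec : E → ℂ
  pos_black : ∀ e, pos (Sum.inr (black e)) =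
    pos (Sum.inl (white e)) + (QuotientAddGroup.mk (vec e) : FlatTorus Λ)

namespace StraightGraph

variable {Λ : Submodule ℤ ℂ} {W B E : Type*}

/-- The point of the edge `e` at parameter `t ∈ [0, 1]`, from white (`t = 0`) to black (`t = 1`). -/
def edgePoint (G : StraightGraph Λ W B E) (e : E) (t : ℝ) : FlatTorus Λ :=
  G.pos (Sum.inl (G.white e)) + (QuotientAddGroup.mk ((t : ℂ) * G.vec e) : FlatTorus Λ)

/-- The subset of the torus covered by the vertices and the edges. -/
def support (G : StraightGraph Λ W B E) : Set (FlatTorus Λ) :=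
  range G.pos ∪ ⋃ e, G.edgePoint e '' Icc 0 1

/-- The faces: the connected components of the complement of the graph. -/
def IsFace (G : StraightGraph Λ W B E) (f : Set (FlatTorus Λ)) : Prop :=
  ∃ x ∈ G.supportᶜ, f = connectedComponentIn G.supportᶜ x

/-- A toric graph: the drawing is an embedding (distinct vertices have distinct positions, and an
interior point of an edge is not a vertex, nor a point of the same edge at another parameter, nor
an interior point of another edge), and all faces are contractible. -/
structure IsToric (G : StraightGraph Λ W B E) : Prop where
  pos_injective : Function.Injective G.pos
  edgePoint_ne_pos : ∀ e, ∀ t ∈ Ioo (0 : ℝ) 1, ∀ v, G.edgePoint e t ≠ G.pos v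
  edgePoint_injective : ∀ e e' : E, ∀ t ∈ Ioo (0 : ℝ) 1, ∀ t' ∈ Ioo (0 : ℝ) 1,
    G.edgePoint e t = G.edgePoint e' t' → e = e' ∧ t = t'
  contractible_of_isFace : ∀ f, G.IsFace f → ContractibleSpace f

/-- There are no univalent vertices. -/
def IsLeafless (G : StraightGraph Λ W B E) : Prop :=
  (∀ w : W, {e | G.white e = w}.ncard ≠ 1) ∧ (∀ b : B, {e | G.black e = b}.ncard ≠ 1)

/-! ### Darts, i.e. edges with a direction of traversal

The dart `(e, true)` traverses `e` from white to black, and `(e, false)` from black to white. -/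

/-- The initial vertex of a dart. -/
def dartSrc (G : StraightGraph Λ W B E) (d : E × Bool) : W ⊕ B :=
  if d.2 then Sum.inl (G.white d.1) else Sum.inr (G.black d.1)

/-- The final vertex of a dart. -/
def dartDst (G : StraightGraph Λ W B E) (d : E × Bool) : W ⊕ B :=
  if d.2 then Sum.inr (G.black d.1) else Sum.inl (G.white d.1)

/-- The displacement vector of a dart, from its initial to its final vertex. -/
def dartVec (G : StraightGraph Λ W B E) (d : E × Bool) : ℂ :=
  if d.2 then G.vec d.1 else -G.vec d.1

/-- The set `f` lies immediately to the left of the dart `d`: every point obtained from an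
interior point of `d` by a sufficiently small shift to the left is in `f`. -/
def LiesLeftOf (G : StraightGraph Λ W B E) (f : Set (FlatTorus Λ)) (d : E × Bool) : Prop :=
  ∀ t ∈ Ioo (0 : ℝ) 1, ∀ᶠ s : ℝ in 𝓝[>] 0,
    G.pos (G.dartSrc d) +
      (QuotientAddGroup.mk (((t : ℂ) + (s : ℂ) * I) * G.dartVec d) : FlatTorus Λ) ∈ f

open Classical in
/-- The boundary of a face `f`, traversed counterclockwise: the darts that have `f` on their left.
These are the sides of the polygon `f'` of which the closure of `f` is the image; an edge with `f`
on both of its sides occurs twice, once in each direction. -/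
def faceBoundary [Fintype E] (G : StraightGraph Λ W B E) (f : Set (FlatTorus Λ)) :
    Finset (E × Bool) :=
  Finset.univ.filter fun d => G.LiesLeftOf f d

/-- The number `l(f)` of sides (equivalently, of vertices) of a face. -/
def faceLength [Fintype E] (G : StraightGraph Λ W B E) (f : Set (FlatTorus Λ)) : ℕ :=
  (G.faceBoundary f).card

/-- The factor that a dart contributes to an alternating product of the numbers `k`. Along a walk
in a bipartite graph the two directions alternate, so `k e` and `(k e)⁻¹` alternate as well. -/
def dartFactor (k : E → ℂ) (d : E × Bool) : ℂ :=
  if d.2 then k d.1 else (k d.1)⁻¹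

/-- The darts `d 0, …, d (n - 1)` form a closed walk (with `d n = d 0`). -/
def IsClosedWalk (G : StraightGraph Λ W B E) (n : ℕ) (d : ℕ → E × Bool) : Prop :=
  (∀ i < n, G.dartDst (d i) = G.dartSrc (d (i + 1))) ∧ d n = d 0

/-- A fractional Kasteleyn marking: non-zero complex numbers on the edges such that the
alternating product around every face `f` is `(-1) ^ (l(f) / 2 + 1)`, where `l(f)` is even, and
the alternating product along every cycle is `1` or `-1`. -/
structure IsFractionalKasteleynMarking [Fintype E] (G : StraightGraph Λ W B E) (k : E → ℂ) :
    Prop where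
  ne_zero : ∀ e, k e ≠ 0
  face : ∀ f, G.IsFace f → ∃ m : ℕ, G.faceLength f = 2 * m ∧
    ∏ d ∈ G.faceBoundary f, dartFactor k d = (-1) ^ (m + 1)
  cycle : ∀ (n : ℕ) (d : ℕ → E × Bool), G.IsClosedWalk n d →
    ∏ i ∈ Finset.range n, dartFactor k (d i) = 1 ∨ ∏ i ∈ Finset.range n, dartFactor k (d i) = -1

/-- A perfect orientation: every white vertex has exactly one incoming edge and every black vertex
has exactly one outgoing edge. Here `toBlack e` is `true` if `e` is oriented from white to black,
and `false` if it is oriented from black to white. -/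
structure PerfectOrientation (G : StraightGraph Λ W B E) where
  /-- the direction of each edge -/
  toBlack : E → Bool
  existsUnique_in : ∀ w : W, ∃! e, G.white e = w ∧ toBlack e = false
  existsUnique_out : ∀ b : B, ∃! e, G.black e = b ∧ toBlack e = false

namespace PerfectOrientation

variable {G : StraightGraph Λ W B E}

/-- The edge `e` as a vector pointing in the direction of its orientation. -/
def edgeVec (o : G.PerfectOrientation) (e : E) : ℂ := G.dartVec (e, o.toBlack e)

/-- The predecessor `e₋` of a white-to-black edge: the incoming edge at its white end. -/
def pred (o : G.PerfectOrientation) (e : E) : E :=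
  Classical.choose (o.existsUnique_in (G.white e)).exists

/-- The successor `e₊` of a white-to-black edge: the outgoing edge at its black end. -/
def succ (o : G.PerfectOrientation) (e : E) : E :=
  Classical.choose (o.existsUnique_out (G.black e)).exists

/-- The signed angle `α₋` from the vector of `e₋` to the vector of `e`. -/
def angleMinus (o : G.PerfectOrientation) (e : E) : ℝ :=
  arg (o.edgeVec e / o.edgeVec (o.pred e))

/-- The signed angle `α₊` from the vector of `e` to the vector of `e₊`. -/
def anglePlus (o : G.PerfectOrientation) (e : E) : ℝ :=
  arg (o.edgeVec (o.succ e) / o.edgeVec e)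

/-- The turning number of a white-to-black edge. -/
def turn (o : G.PerfectOrientation) (e : E) : ℂ :=
  exp (I / 2 * ((o.angleMinus e : ℂ) + (o.anglePlus e : ℂ)))

/-- The turning number on the white-to-black edges, and `-1` on the black-to-white edges. -/
def marking (o : G.PerfectOrientation) (e : E) : ℂ :=
  if o.toBlack e then o.turn e else -1

end PerfectOrientation

end StraightGraph

end

/-!
Lift the face to the plane, with the coordinate chosen so that no edge is vertical. Cut the lift of
the face along the vertical segments going up from those corners that contain an upward vertical
direction. Each piece is the strip above one side with the face over it (a floor side), and the
pieces and the cuts form the vertices and the edges of a tree, so there is one floor side more than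
there are cuts: the face is connected, and on a simply connected set a branch of the argument around
a corner `p` yields a function that jumps across the cut from `p` and across no cut to the left of
it.

Measure half angles with a branch cut along the upward vertical. Their quotients over the corners of
the face telescope to a factor `I` for each floor side and `-I` for each other side, while each cut
contributes a sign. Hence the product of `exp (-I * θ / 2)` over the corner angles `θ` of a face
with `2 * m` sides is `(-1) ^ (m + 1)`, which is Gauss-Bonnet for the face.

If instead the half angles at each vertex are measured from its black-to-white edge, the product
becomes the alternating product of the marking. Finally, the square of the factor of a dart is a
quotient of values of a function of its end vertices, so it telescopes to `1` along closed walks.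
-/

noncomputable section

/-! ### Angles in the plane -/

section Angle

variable {y x c w v : ℂ}

/-- The counterclockwise angle from `y` to `x`, with values in `(0, 2π]` rather than `[0, 2π)`:
the sector from a vector to itself is the full punctured plane. -/
def ccwAngle (y x : ℂ) : ℝ := arg (-(x / y)) + Real.pi

lemma ccwAngle_pos (y x : ℂ) : 0 < ccwAngle y x := by
  linarith [neg_pi_lt_arg (-(x / y)), ccwAngle.eq_1 y x]

lemma ccwAngle_le_two_pi (y x : ℂ) : ccwAngle y x ≤ 2 * Real.pi := by
  linarith [arg_le_pi (-(x / y)), ccwAngle.eq_1 y x]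

lemma ccwAngle_div_div (y x : ℂ) (hc : c ≠ 0) : ccwAngle (y / c) (x / c) = ccwAngle y x := by
  rw [ccwAngle, ccwAngle, div_div_div_cancel_right₀ hc]

lemma ccwAngle_real_mul (y x : ℂ) {t : ℝ} (ht : 0 < t) : ccwAngle y (t * x) = ccwAngle y x := by
  rw [ccwAngle, ccwAngle, mul_div_assoc, ← mul_neg, arg_real_mul _ ht]

-- The map `z ↦ -conj z` is the reflection in the vertical axis, which reverses orientation.
lemma ccwAngle_neg_conj (y x : ℂ) :
    ccwAngle (-(starRingEnd ℂ) x) (-(starRingEnd ℂ) y) = ccwAngle y x := by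
  have h : -(-(starRingEnd ℂ) y / -(starRingEnd ℂ) x) = (starRingEnd ℂ) (-(x / y))⁻¹ := by
    rw [neg_div_neg_eq, inv_neg, inv_div, map_neg, map_div₀]
  have hlt := neg_pi_lt_arg (-(x / y))
  rw [ccwAngle, ccwAngle, h, arg_conj, arg_inv]
  split_ifs <;> grind

lemma exp_ccwAngle_mul_I (y x : ℂ) : exp (ccwAngle y x * I) = -exp (arg (-(x / y)) * I) := by
  rw [ccwAngle, ofReal_add, add_mul, Complex.exp_add, exp_pi_mul_I, mul_neg_one]

lemma exists_eq_mul_exp_ccwAngle (hy : y ≠ 0) (hx : x ≠ 0) :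
    ∃ r : ℝ, 0 < r ∧ x = r * y * exp (ccwAngle y x * I) := by
  refine ⟨‖x / y‖, norm_pos_iff.2 (div_ne_zero hx hy), ?_⟩
  have hpolar := norm_mul_exp_arg_mul_I (-(x / y))
  rw [norm_neg] at hpolar
  rw [exp_ccwAngle_mul_I]
  linear_combination y * hpolar - div_mul_cancel₀ x hy

lemma ccwAngle_eq_of_eq_mul_exp (hy : y ≠ 0) {r θ : ℝ} (hr : 0 < r) (hθ : 0 < θ)
    (hθ' : θ ≤ 2 * Real.pi) (h : x = r * y * exp (θ * I)) : ccwAngle y x = θ := by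
  have hpolar : -(x / y) = r * (Complex.cos ((θ - Real.pi : ℝ) : ℂ) +
      Complex.sin ((θ - Real.pi : ℝ) : ℂ) * I) := by
    rw [← exp_mul_I, h, ofReal_sub, sub_mul, Complex.exp_sub, exp_pi_mul_I]
    field_simp
  rw [ccwAngle, hpolar, arg_mul_cos_add_sin_mul_I hr ⟨by linarith, by linarith⟩]
  ring

lemma ccwAngle_self (hy : y ≠ 0) : ccwAngle y y = 2 * Real.pi := by
  simp [ccwAngle, hy, two_mul]

lemma ccwAngle_eq_sub_of_lt (hy : y ≠ 0) (hx : x ≠ 0) (hc : c ≠ 0)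
    (h : ccwAngle y c < ccwAngle y x) : ccwAngle c x = ccwAngle y x - ccwAngle y c := by
  obtain ⟨r, hr, hrx⟩ := exists_eq_mul_exp_ccwAngle hy hx
  obtain ⟨s, hs, hsc⟩ := exists_eq_mul_exp_ccwAngle hy hc
  have hpos := ccwAngle_pos y c
  have hle := ccwAngle_le_two_pi y x
  refine ccwAngle_eq_of_eq_mul_exp hc (div_pos hr hs) (by linarith) (by linarith) ?_
  generalize ccwAngle y x = α at *
  generalize ccwAngle y c = β at *
  have hs' : (s : ℂ) ≠ 0 := ofReal_ne_zero.2 hs.ne'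
  rw [hrx, hsc, ofReal_sub, ofReal_div, sub_mul, Complex.exp_sub]
  field_simp

lemma ccwAngle_eq_sub_add_two_pi_of_le (hy : y ≠ 0) (hx : x ≠ 0) (hc : c ≠ 0)
    (h : ccwAngle y x ≤ ccwAngle y c) :
    ccwAngle c x = ccwAngle y x - ccwAngle y c + 2 * Real.pi := by
  obtain ⟨r, hr, hrx⟩ := exists_eq_mul_exp_ccwAngle hy hx
  obtain ⟨s, hs, hsc⟩ := exists_eq_mul_exp_ccwAngle hy hc
  have hpos := ccwAngle_pos y x
  have hle := ccwAngle_le_two_pi y c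
  refine ccwAngle_eq_of_eq_mul_exp hc (div_pos hr hs) (by linarith) (by linarith) ?_
  generalize ccwAngle y x = α at *
  generalize ccwAngle y c = β at *
  have hs' : (s : ℂ) ≠ 0 := ofReal_ne_zero.2 hs.ne'
  rw [hrx, hsc]
  push_cast
  rw [add_mul, Complex.exp_add, exp_two_pi_mul_I, sub_mul, Complex.exp_sub]
  field_simp

lemma ccwAngle_comm_eq_two_pi_sub (hy : y ≠ 0) (hc : c ≠ 0) (h : ccwAngle y c < 2 * Real.pi) :
    ccwAngle c y = 2 * Real.pi - ccwAngle y c := by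
  rw [← ccwAngle_self hy] at h ⊢
  exact ccwAngle_eq_sub_of_lt hy hy hc h

lemma ccwAngle_comm_eq_two_pi (hy : y ≠ 0) (hc : c ≠ 0) (h : ccwAngle y c = 2 * Real.pi) :
    ccwAngle c y = 2 * Real.pi := by
  have hle : ccwAngle y y ≤ ccwAngle y c := by rw [h, ccwAngle_self hy]
  rw [ccwAngle_eq_sub_add_two_pi_of_le hy hy hc hle, h, ccwAngle_self hy]
  ring

lemma ccwAngle_eq_add_of_add_le (hy : y ≠ 0) (hx : x ≠ 0) (hc : c ≠ 0)
    (h : ccwAngle y c + ccwAngle c x ≤ 2 * Real.pi) :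
    ccwAngle y x = ccwAngle y c + ccwAngle c x := by
  rcases lt_or_ge (ccwAngle y c) (ccwAngle y x) with hlt | hle
  · linarith [ccwAngle_eq_sub_of_lt hy hx hc hlt]
  · linarith [ccwAngle_eq_sub_add_two_pi_of_le hy hx hc hle, ccwAngle_pos y x]

lemma ccwAngle_eq_two_pi_iff (hy : y ≠ 0) (hx : x ≠ 0) :
    ccwAngle y x = 2 * Real.pi ↔ ∃ r : ℝ, 0 < r ∧ x = r * y := by
  constructor
  · intro h
    obtain ⟨r, hr, hrx⟩ := exists_eq_mul_exp_ccwAngle hy hx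
    refine ⟨r, hr, ?_⟩
    rw [h] at hrx
    push_cast at hrx
    rwa [exp_two_pi_mul_I, mul_one] at hrx
  · rintro ⟨r, hr, rfl⟩
    rw [ccwAngle_real_mul y y hr, ccwAngle_self hy]

lemma exists_pos_mul_of_ccwAngle_eq (hy : y ≠ 0) (hx : x ≠ 0) (hc : c ≠ 0)
    (h : ccwAngle y x = ccwAngle y c) : ∃ r : ℝ, 0 < r ∧ c = r * x := by
  have htwo := ccwAngle_eq_sub_add_two_pi_of_le hy hc hx h.ge
  rw [h, sub_self, zero_add] at htwo
  exact (ccwAngle_eq_two_pi_iff hx hc).1 htwo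

lemma exists_pos_mul_of_ccwAngle_left_eq (hy : y ≠ 0) (hx : x ≠ 0) (hc : c ≠ 0)
    (h : ccwAngle y x = ccwAngle c x) : ∃ r : ℝ, 0 < r ∧ c = r * y := by
  obtain ⟨r, hr, hry⟩ := exists_pos_mul_of_ccwAngle_eq (y := -(starRingEnd ℂ) x)
    (x := -(starRingEnd ℂ) y) (c := -(starRingEnd ℂ) c) (by simpa using hx) (by simpa using hy)
    (by simpa using hc) (by rw [ccwAngle_neg_conj, ccwAngle_neg_conj, h])
  exact ⟨r, hr, by simpa using congrArg (starRingEnd ℂ) hry⟩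

lemma ccwAngle_lt_pi_iff : ccwAngle y x < Real.pi ↔ 0 < (x / y).im := by
  rw [ccwAngle, add_lt_iff_neg_right, arg_neg_iff, neg_im, neg_lt_zero]

lemma pi_lt_ccwAngle (h : (x / y).im < 0) : Real.pi < ccwAngle y x := by
  have hle : Real.pi ≤ ccwAngle y x := not_lt.1 (mt ccwAngle_lt_pi_iff.1 h.le.not_gt)
  refine hle.lt_of_ne fun heq => ?_
  have harg : arg (-(x / y)) = 0 := by linarith [ccwAngle.eq_1 y x]
  linarith [(arg_eq_zero_iff.1 harg).2, neg_im (x / y)]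

lemma im_div_pos_iff (hy : y ≠ 0) : 0 < (x / y).im ↔ 0 < y.re * x.im - y.im * x.re := by
  rw [div_im, ← sub_div, div_pos_iff_of_pos_right (normSq_pos.2 hy), mul_comm x.im, mul_comm x.re]

lemma ccwAngle_I_right_lt_pi (hy : 0 < y.re) : ccwAngle y I < Real.pi := by
  have hy0 : y ≠ 0 := by rintro rfl; simp at hy
  rw [ccwAngle_lt_pi_iff, im_div_pos_iff hy0]
  simpa using hy

lemma ccwAngle_I_left_lt_pi (hx : x.re < 0) : ccwAngle I x < Real.pi := by
  rw [ccwAngle_lt_pi_iff, im_div_pos_iff I_ne_zero]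
  simpa using hx

lemma pi_lt_ccwAngle_I_right (hy : y.re < 0) : Real.pi < ccwAngle y I := by
  have hy0 : y ≠ 0 := by rintro rfl; simp at hy
  refine pi_lt_ccwAngle ?_
  have h : 0 < (I / -y).im := (im_div_pos_iff (neg_ne_zero.2 hy0)).2 (by simpa using hy)
  rwa [div_neg, neg_im, neg_pos] at h

lemma ccwAngle_I_right_le_pi (hw : 0 < w.re ∨ w.re = 0 ∧ w.im < 0) : ccwAngle w I ≤ Real.pi := by
  rcases hw with hw | ⟨hre, him⟩
  · exact (ccwAngle_I_right_lt_pi hw).le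
  · obtain ⟨a, ha, rfl⟩ : ∃ a : ℝ, a < 0 ∧ w = a * I :=
      ⟨w.im, him, Complex.ext (by simp [hre]) (by simp)⟩
    have hdiv : -(I / (a * I)) = ((-a)⁻¹ : ℝ) := by
      rw [← div_div, div_right_comm, div_self I_ne_zero]
      push_cast
      rw [inv_neg, one_div]
    rw [ccwAngle, hdiv, arg_ofReal_of_nonneg (inv_nonneg.2 (by linarith)), zero_add]

lemma ccwAngle_lt_of_mem_cone_right (hy : 0 < y.re) {t s : ℝ} (ht : 0 < t) (hs : 0 < s) :
    ccwAngle y (t * y + s * I) < ccwAngle y I := by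
  set w : ℂ := t * y + s * I with hw
  have hwre : w.re = t * y.re := by simp [hw]
  have hwim : w.im = t * y.im + s := by simp [hw]
  have hwpos : 0 < w.re := by rw [hwre]; positivity
  have hy0 : y ≠ 0 := by rintro rfl; simp at hy
  have hw0 : w ≠ 0 := by rintro h; simp [h] at hwpos
  by_contra! h
  have hwI : ccwAngle w I < Real.pi := ccwAngle_I_right_lt_pi hwpos
  have hyw : ccwAngle y w < Real.pi := by
    rw [ccwAngle_lt_pi_iff, im_div_pos_iff hy0, hwre, hwim]
    linarith [mul_pos hs hy]
  linarith [ccwAngle_eq_sub_add_two_pi_of_le hy0 I_ne_zero hw0 h, ccwAngle_pos y I]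

lemma ccwAngle_lt_of_re_neg (hy : y.re < 0) (hw : 0 < w.re ∨ w.re = 0 ∧ w.im < 0) :
    ccwAngle y w < ccwAngle y I := by
  have hy0 : y ≠ 0 := by rintro rfl; simp at hy
  have hw0 : w ≠ 0 := by rintro rfl; simp at hw
  by_contra! h
  linarith [ccwAngle_eq_sub_add_two_pi_of_le hy0 I_ne_zero hw0 h, ccwAngle_I_right_le_pi hw,
    pi_lt_ccwAngle_I_right hy, ccwAngle_le_two_pi y w]

lemma ccwAngle_I_left_lt_of_reflect (hx : x ≠ 0) (hw : w ≠ 0)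
    (h : ccwAngle (-(starRingEnd ℂ) x) (-(starRingEnd ℂ) w) < ccwAngle (-(starRingEnd ℂ) x) I) :
    ccwAngle I w < ccwAngle I x := by
  have hsub := ccwAngle_eq_sub_of_lt (by simpa using hx) I_ne_zero (by simpa using hw) h
  have hreflect : ∀ z, ccwAngle (-(starRingEnd ℂ) z) I = ccwAngle I z := fun z => by
    simpa using ccwAngle_neg_conj I z
  have hpos := ccwAngle_pos (-(starRingEnd ℂ) x) (-(starRingEnd ℂ) w)
  rw [hreflect, hreflect] at hsub
  linarith

lemma ccwAngle_lt_of_mem_cone_left (hx : x.re < 0) {t s : ℝ} (ht : 0 < t) (hs : 0 < s) :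
    ccwAngle I (t * x + s * I) < ccwAngle I x := by
  refine ccwAngle_I_left_lt_of_reflect (by rintro rfl; simp at hx) (fun h => ?_) ?_
  · have hre := congrArg re h
    simp [ht.ne', hx.ne] at hre
  · have hcone := ccwAngle_lt_of_mem_cone_right (y := -(starRingEnd ℂ) x) (by simpa using hx) ht hs
    convert hcone using 2
    simp only [map_add, map_mul, conj_ofReal, conj_I]
    ring

lemma ccwAngle_lt_of_re_pos (hx : 0 < x.re) (hw : w.re < 0 ∨ w.re = 0 ∧ w.im < 0) :
    ccwAngle I w < ccwAngle I x :=
  ccwAngle_I_left_lt_of_reflect (by rintro rfl; simp at hx) (by rintro rfl; simp at hw)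
    (ccwAngle_lt_of_re_neg (by simpa using hx) (by simpa using hw))

lemma neg_div_I_mem_slitPlane (h : ∀ s : ℝ, 0 ≤ s → w ≠ s * I) : -(w / I) ∈ slitPlane := by
  rw [mem_slitPlane_iff]
  by_contra! hcon
  simp only [div_I, neg_neg, mul_re, I_re, mul_zero, I_im, mul_one, zero_sub, mul_im, add_zero,
    Left.neg_nonpos_iff] at hcon
  exact h w.im hcon.1 (Complex.ext (by simp [hcon.2]) (by simp))

lemma ccwAngle_I_lt_of_upper_left (hre : w.re < 0) (him : 0 < w.im) :
    ccwAngle I w < Real.pi / 2 := by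
  have hneg := arg_neg_iff.2 (show (-(w / I)).im < 0 by simpa using hre)
  have habs := mt abs_arg_le_pi_div_two_iff.1 (show ¬0 ≤ (-(w / I)).re by simpa using him)
  rw [not_le, abs_of_neg hneg] at habs
  linarith [ccwAngle.eq_1 I w]

lemma lt_ccwAngle_I_of_upper_right (hre : 0 < w.re) (him : 0 < w.im) :
    3 * Real.pi / 2 < ccwAngle I w := by
  have hnonneg := arg_nonneg_iff.2 (show 0 ≤ (-(w / I)).im by simpa using hre.le)
  have habs := mt abs_arg_le_pi_div_two_iff.1 (show ¬0 ≤ (-(w / I)).re by simpa using him)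
  rw [not_le, abs_of_nonneg hnonneg] at habs
  linarith [ccwAngle.eq_1 I w]

lemma ccwAngle_I_of_re_pos (hv : 0 < v.re) : ccwAngle I v = ccwAngle I (-v) + Real.pi := by
  have hv0 : -v ≠ 0 := by rw [neg_ne_zero]; rintro rfl; simp at hv
  have hlt : ccwAngle I (-v) < Real.pi := ccwAngle_I_left_lt_pi (by simpa using hv)
  have hpos := ccwAngle_pos I (-v)
  obtain ⟨r, hr, h⟩ := exists_eq_mul_exp_ccwAngle I_ne_zero hv0
  refine ccwAngle_eq_of_eq_mul_exp I_ne_zero hr (by linarith [Real.pi_pos]) (by linarith) ?_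
  rw [ofReal_add, add_mul, Complex.exp_add, exp_pi_mul_I]
  linear_combination -h

end Angle

section HalfAngle

variable {y x c v : ℂ}

/-- The unit complex number whose argument is half that of `-v / c`: a square root of the direction
of `v`, continuous off the cut along the ray of `c`. -/
def halfAngle (c v : ℂ) : ℂ := exp (I / 2 * ((ccwAngle c v - Real.pi : ℝ) : ℂ))

lemma norm_real_mul_exp {r : ℝ} (hr : 0 ≤ r) (v : ℂ) (θ : ℝ) :
    ‖r * v * exp (θ * I)‖ = r * ‖v‖ := by
  rw [norm_mul, norm_mul, norm_exp_ofReal_mul_I, norm_real, Real.norm_of_nonneg hr, mul_one]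

lemma halfAngle_sq (hc : c ≠ 0) (hv : v ≠ 0) :
    halfAngle c v ^ 2 = -(v / ‖v‖) / (c / ‖c‖) := by
  obtain ⟨r, hr, hrv⟩ := exists_eq_mul_exp_ccwAngle hc hv
  have hsq : halfAngle c v ^ 2 = -exp (ccwAngle c v * I) := by
    rw [halfAngle, ← Complex.exp_nat_mul]
    push_cast
    rw [show (2 : ℂ) * (I / 2 * (ccwAngle c v - Real.pi)) = ccwAngle c v * I - Real.pi * I by ring,
      Complex.exp_sub, exp_pi_mul_I, div_neg, div_one]
  have hnorm : ‖v‖ = r * ‖c‖ := by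
    conv_lhs => rw [hrv]
    exact norm_real_mul_exp hr.le c _
  have hr' : (r : ℂ) ≠ 0 := ofReal_ne_zero.2 hr.ne'
  have hc' : (‖c‖ : ℂ) ≠ 0 := ofReal_ne_zero.2 (norm_ne_zero_iff.2 hc)
  rw [hsq, hnorm]
  conv_rhs => rw [hrv]
  push_cast
  field_simp

lemma halfAngle_div_halfAngle (c y x : ℂ) : halfAngle c y / halfAngle c x =
    exp (-(I / 2) * ((ccwAngle c x - ccwAngle c y : ℝ) : ℂ)) := by
  rw [halfAngle, halfAngle, ← Complex.exp_sub]
  push_cast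
  ring_nf

open Classical in
lemma ccwAngle_sub_ccwAngle (hy : y ≠ 0) (hx : x ≠ 0) (hc : c ≠ 0) :
    ccwAngle c x - ccwAngle c y = ccwAngle y x -
      if ccwAngle y c < ccwAngle y x ∨ ccwAngle y c = 2 * Real.pi then 2 * Real.pi else 0 := by
  rcases lt_or_ge (ccwAngle y c) (ccwAngle y x) with hlt | hle
  · rw [if_pos (Or.inl hlt), ccwAngle_eq_sub_of_lt hy hx hc hlt,
      ccwAngle_comm_eq_two_pi_sub hy hc (hlt.trans_le (ccwAngle_le_two_pi _ _))]
    ring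
  · rw [ccwAngle_eq_sub_add_two_pi_of_le hy hx hc hle]
    rcases (ccwAngle_le_two_pi y c).lt_or_eq with hlt | heq
    · rw [if_neg (not_or.2 ⟨hle.not_gt, hlt.ne⟩), ccwAngle_comm_eq_two_pi_sub hy hc hlt]
      ring
    · rw [if_pos (Or.inr heq), ccwAngle_comm_eq_two_pi hy hc heq, heq]
      ring

open Classical in
-- The sign records whether the cut lies in the open sector from `y` to `x` or along its first
-- side.
lemma halfAngle_div_halfAngle_eq_exp_ccwAngle (hy : y ≠ 0) (hx : x ≠ 0) (hc : c ≠ 0) :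
    halfAngle c y / halfAngle c x = exp (-(I / 2) * ccwAngle y x) *
      if ccwAngle y c < ccwAngle y x ∨ ccwAngle y c = 2 * Real.pi then -1 else 1 := by
  rw [halfAngle_div_halfAngle, ccwAngle_sub_ccwAngle hy hx hc]
  split_ifs
  · rw [ofReal_sub, mul_sub, Complex.exp_sub]
    push_cast
    rw [show -(I / 2) * (2 * Real.pi) = -(Real.pi * I) by ring, Complex.exp_neg, exp_pi_mul_I]
    norm_num [div_neg]
  · rw [sub_zero, mul_one]

lemma halfAngle_I_div_neg_of_re_pos (hv : 0 < v.re) : halfAngle I v / halfAngle I (-v) = I := by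
  rw [halfAngle_div_halfAngle, ccwAngle_I_of_re_pos hv, sub_add_cancel_left, ofReal_neg,
    show -(I / 2) * -(Real.pi : ℂ) = Real.pi / 2 * I by ring, exp_pi_div_two_mul_I]

lemma halfAngle_I_div_neg (hv : v.re ≠ 0) :
    halfAngle I v / halfAngle I (-v) = if 0 < v.re then I else -I := by
  split_ifs with h
  · exact halfAngle_I_div_neg_of_re_pos h
  · have hneg := halfAngle_I_div_neg_of_re_pos (v := -v)
      (by simpa using lt_of_le_of_ne (not_lt.1 h) hv)
    rw [neg_neg] at hneg
    rw [← inv_div, hneg, inv_I]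

end HalfAngle

/-! ### Half-planes and sectors -/

section Sector

variable {p b y x v : ℂ}

/-- The open half-plane to the left of the line through `b` in the direction of `v`. -/
def leftHalfPlane (b v : ℂ) : Set ℂ := {z | 0 < ((z - b) / v).im}

/-- The open sector with apex `p` swept when turning counterclockwise from `y` to `x`. -/
def openSector (p y x : ℂ) : Set ℂ := {z | z ≠ p ∧ ccwAngle y (z - p) < ccwAngle y x}

lemma convex_leftHalfPlane (b v : ℂ) : Convex ℝ (leftHalfPlane b v) := by
  have hlin : IsLinearMap ℝ fun z : ℂ => (z / v).im :=
    ⟨fun z w => by rw [add_div, add_im], fun t z => by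
      rw [real_smul, mul_div_assoc, im_ofReal_mul, smul_eq_mul]⟩
  simpa only [leftHalfPlane, sub_div, sub_im, sub_pos] using
    convex_halfSpace_gt hlin (b / v).im

lemma add_mul_mem_leftHalfPlane_iff (hv : v ≠ 0) (b w : ℂ) :
    b + w * v ∈ leftHalfPlane b v ↔ 0 < w.im := by
  simp [leftHalfPlane, hv]

lemma tendsto_add_mul_leftHalfPlane (hv : v ≠ 0) (b : ℂ) (τ : ℝ) :
    Tendsto (fun s : ℝ => b + (τ + s * I) * v) (𝓝[>] 0) (𝓝[leftHalfPlane b v] (b + τ * v)) := by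
  refine tendsto_nhdsWithin_of_tendsto_nhds_of_eventually_within _ ?_ ?_
  · exact (Continuous.tendsto' (by fun_prop) _ _ (by simp)).mono_left nhdsWithin_le_nhds
  · filter_upwards [self_mem_nhdsWithin] with s hs
    exact (add_mul_mem_leftHalfPlane_iff hv b _).2 (by simpa using hs)

lemma openSector_inter_ball_eq_image (hy : y ≠ 0) (p x : ℂ) (ε : ℝ) :
    Metric.ball p ε ∩ openSector p y x =
      (fun a : ℝ × ℝ => p + a.1 * y * exp (a.2 * I)) ''
        (Ioo 0 (ε / ‖y‖) ×ˢ Ioo 0 (ccwAngle y x)) := by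
  have hy' : 0 < ‖y‖ := norm_pos_iff.2 hy
  ext z
  constructor
  · rintro ⟨hz, hzp, hz'⟩
    obtain ⟨r, hr, h⟩ := exists_eq_mul_exp_ccwAngle hy (sub_ne_zero.2 hzp)
    refine ⟨(r, ccwAngle y (z - p)), ⟨⟨hr, ?_⟩, ccwAngle_pos _ _, hz'⟩, ?_⟩
    · rw [Metric.mem_ball, dist_eq_norm, h, norm_real_mul_exp hr.le] at hz
      exact (lt_div_iff₀ hy').2 hz
    · simp only [← h, add_sub_cancel]
  · rintro ⟨⟨r, θ⟩, ⟨⟨hr, hr'⟩, hθ, hθ'⟩, rfl⟩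
    refine ⟨?_, ?_, ?_⟩
    · rw [Metric.mem_ball, dist_eq_norm, add_sub_cancel_left, norm_real_mul_exp hr.le]
      exact (lt_div_iff₀ hy').1 hr'
    · simpa [hy] using hr.ne'
    · rwa [add_sub_cancel_left, ccwAngle_eq_of_eq_mul_exp hy hr hθ
        (hθ'.le.trans (ccwAngle_le_two_pi _ _)) rfl]

lemma isPreconnected_ball_inter_openSector (hy : y ≠ 0) (p x : ℂ) (ε : ℝ) :
    IsPreconnected (Metric.ball p ε ∩ openSector p y x) := by
  rw [openSector_inter_ball_eq_image hy]
  exact (isPreconnected_Ioo.prod isPreconnected_Ioo).image _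
    (Continuous.continuousOn (by fun_prop))

lemma rotate_first_side_mem_openSector (hy : y ≠ 0) {ρ δ : ℝ} (hρ : 0 < ρ)
    (hδ : δ ∈ Ioo 0 (ccwAngle y x)) : p + ρ * y * exp (δ * I) ∈ openSector p y x := by
  refine ⟨by simp [hρ.ne', hy], ?_⟩
  rw [add_sub_cancel_left, ccwAngle_eq_of_eq_mul_exp hy hρ hδ.1
    (hδ.2.le.trans (ccwAngle_le_two_pi _ _)) rfl]
  exact hδ.2

lemma rotate_second_side_mem_openSector (hy : y ≠ 0) (hx : x ≠ 0) {ρ δ : ℝ} (hρ : 0 < ρ)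
    (hδ : δ ∈ Ioo 0 (ccwAngle y x)) : p + ρ * x * exp ((-δ : ℝ) * I) ∈ openSector p y x := by
  obtain ⟨r, hr, hrx⟩ := exists_eq_mul_exp_ccwAngle hy hx
  have hle := ccwAngle_le_two_pi y x
  have hangle : ccwAngle y (ρ * x * exp ((-δ : ℝ) * I)) = ccwAngle y x - δ := by
    refine ccwAngle_eq_of_eq_mul_exp hy (mul_pos hρ hr) (by linarith [hδ.2])
      (by linarith [hδ.1]) ?_
    generalize ccwAngle y x = α at *
    rw [hrx]
    push_cast
    rw [neg_mul, Complex.exp_neg, sub_mul, Complex.exp_sub]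
    ring
  refine ⟨by simp [hρ.ne', hx], ?_⟩
  rw [add_sub_cancel_left, hangle]
  linarith [hδ.1]

lemma tendsto_rotate_leftHalfPlane (hv : v ≠ 0) (b : ℂ) {ρ : ℝ} (hρ : 0 < ρ) :
    Tendsto (fun δ : ℝ => b + ρ * v * exp (δ * I)) (𝓝[>] 0)
      (𝓝[leftHalfPlane b v] (b + ρ * v)) := by
  refine tendsto_nhdsWithin_of_tendsto_nhds_of_eventually_within _ ?_ ?_
  · exact (Continuous.tendsto' (by fun_prop) _ _ (by simp)).mono_left nhdsWithin_le_nhds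
  · filter_upwards [Ioo_mem_nhdsGT Real.pi_pos] with δ hδ
    rw [mul_right_comm, add_mul_mem_leftHalfPlane_iff hv, im_ofReal_mul, exp_ofReal_mul_I_im]
    exact mul_pos hρ (Real.sin_pos_of_pos_of_lt_pi hδ.1 hδ.2)

lemma tendsto_rotate_end_leftHalfPlane (hv : v ≠ 0) (b : ℂ) {ρ : ℝ} (hρ : 0 < ρ) :
    Tendsto (fun δ : ℝ => b + v + ρ * (-v) * exp ((-δ : ℝ) * I)) (𝓝[>] 0)
      (𝓝[leftHalfPlane b v] (b + (1 - ρ : ℝ) * v)) := by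
  refine tendsto_nhdsWithin_of_tendsto_nhds_of_eventually_within _ ?_ ?_
  · refine (Continuous.tendsto' (by fun_prop) _ _ ?_).mono_left nhdsWithin_le_nhds
    push_cast
    simp only [neg_zero, zero_mul, Complex.exp_zero]
    ring
  · filter_upwards [Ioo_mem_nhdsGT Real.pi_pos] with δ hδ
    rw [show b + v + ρ * (-v) * exp ((-δ : ℝ) * I) = b + (1 - ρ * exp ((-δ : ℝ) * I)) * v by ring,
      add_mul_mem_leftHalfPlane_iff hv, sub_im, im_ofReal_mul, exp_ofReal_mul_I_im, Real.sin_neg,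
      one_im]
    linarith [mul_pos hρ (Real.sin_pos_of_pos_of_lt_pi hδ.1 hδ.2)]

lemma exists_pos_lt_one_mul_norm_lt {ε : ℝ} (hε : 0 < ε) (v : ℂ) :
    ∃ ρ : ℝ, 0 < ρ ∧ ρ < 1 ∧ ρ * ‖v‖ < ε := by
  have hlim : Tendsto (fun ρ : ℝ => ρ * ‖v‖) (𝓝[>] 0) (𝓝 0) :=
    (Continuous.tendsto' (by fun_prop) _ _ (by simp)).mono_left nhdsWithin_le_nhds
  obtain ⟨ρ, hρ, hlt⟩ :=
    ((eventually_mem_set.2 (Ioo_mem_nhdsGT one_pos)).and (hlim.eventually_lt_const hε)).exists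
  exact ⟨ρ, hρ.1, hρ.2, hlt⟩

lemma exists_frequently_of_eventually_openSector_first_side (hy : y ≠ 0) {q : ℂ → Prop}
    (hq : ∀ᶠ z in 𝓝[openSector p y x] p, q z) :
    ∃ τ ∈ Ioo (0 : ℝ) 1, ∃ᶠ z in 𝓝[leftHalfPlane p y] (p + τ * y), q z := by
  rw [eventually_nhdsWithin_iff, Metric.eventually_nhds_iff_ball] at hq
  obtain ⟨ε, hε, hball⟩ := hq
  obtain ⟨ρ, hρ, hρ1, hρε⟩ := exists_pos_lt_one_mul_norm_lt hε y
  refine ⟨ρ, ⟨hρ, hρ1⟩, (tendsto_rotate_leftHalfPlane hy p hρ).frequently ?_⟩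
  refine Eventually.frequently ?_
  filter_upwards [Ioo_mem_nhdsGT (ccwAngle_pos y x)] with δ hδ
  refine hball _ ?_ (rotate_first_side_mem_openSector hy hρ hδ)
  rwa [Metric.mem_ball, dist_eq_norm, add_sub_cancel_left, norm_real_mul_exp hρ.le]

lemma exists_frequently_of_eventually_openSector_second_side (hy : y ≠ 0) (hv : v ≠ 0)
    {q : ℂ → Prop} (hq : ∀ᶠ z in 𝓝[openSector (b + v) y (-v)] (b + v), q z) :
    ∃ τ ∈ Ioo (0 : ℝ) 1, ∃ᶠ z in 𝓝[leftHalfPlane b v] (b + τ * v), q z := by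
  rw [eventually_nhdsWithin_iff, Metric.eventually_nhds_iff_ball] at hq
  obtain ⟨ε, hε, hball⟩ := hq
  obtain ⟨ρ, hρ, hρ1, hρε⟩ := exists_pos_lt_one_mul_norm_lt hε v
  refine ⟨1 - ρ, ⟨by linarith, by linarith⟩,
    (tendsto_rotate_end_leftHalfPlane hv b hρ).frequently ?_⟩
  refine Eventually.frequently ?_
  filter_upwards [Ioo_mem_nhdsGT (ccwAngle_pos y (-v))] with δ hδ
  refine hball _ ?_ (rotate_second_side_mem_openSector hy (neg_ne_zero.2 hv) hρ hδ)
  rwa [Metric.mem_ball, dist_eq_norm, add_sub_cancel_left, norm_real_mul_exp hρ.le, norm_neg]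

lemma add_mul_I_mem_openSector (h : ccwAngle y I < ccwAngle y x) {s : ℝ} (hs : 0 < s) :
    p + s * I ∈ openSector p y x :=
  ⟨by simp [hs.ne'], by rwa [add_sub_cancel_left, ccwAngle_real_mul y I hs]⟩

lemma tendsto_add_real_mul (p c : ℂ) : Tendsto (fun s : ℝ => p + s * c) (𝓝[>] 0) (𝓝 p) :=
  (Continuous.tendsto' (by fun_prop) _ _ (by simp)).mono_left nhdsWithin_le_nhds

lemma tendsto_add_mul_I_openSector (h : ccwAngle y I < ccwAngle y x) (p : ℂ) :
    Tendsto (fun s : ℝ => p + s * I) (𝓝[>] 0) (𝓝[openSector p y x] p) :=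
  tendsto_nhdsWithin_of_tendsto_nhds_of_eventually_within _ (tendsto_add_real_mul p I)
    (by filter_upwards [self_mem_nhdsWithin] with s hs using add_mul_I_mem_openSector h hs)

end Sector

/-! ### Straight-line drawings in the plane -/

/-- A straight-line drawing in the plane, possibly periodic: the vertices over `v : V` are the
points of `lift v`, and a dart `d : D` starts at every point over `src d`, with displacement
`vec d`. Every edge is represented by two darts, exchanged by `rev`. The field
`exists_ball` expresses local finiteness. -/
structure PlanarDrawing (V D : Type*) where
  /-- the initial vertex of a dart -/
  src : D → V
  /-- the opposite dart -/
  rev : D → D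
  /-- the displacement of a dart -/
  vec : D → ℂ
  /-- the points over a vertex -/
  lift : V → Set ℂ
  rev_rev : ∀ d, rev (rev d) = d
  vec_rev : ∀ d, vec (rev d) = -vec d
  exists_dart : ∀ v, ∃ d, src d = v
  add_vec_mem_lift : ∀ d, ∀ p ∈ lift (src d), p + vec d ∈ lift (src (rev d))
  lift_inj : ∀ v w p, p ∈ lift v → p ∈ lift w → v = w
  lift_nonempty : ∀ v, (lift v).Nonempty
  exists_ball : ∀ p : ℂ, ∃ ε > 0, ∀ d, ∀ b ∈ lift (src d), ∀ t ∈ Icc (0 : ℝ) 1,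
    b + t * vec d ∈ Metric.ball p ε → ∃ t₀ ∈ Icc (0 : ℝ) 1, p = b + t₀ * vec d
  edge_ne_vertex : ∀ d, ∀ b ∈ lift (src d), ∀ t ∈ Ioo (0 : ℝ) 1, ∀ v, b + t * vec d ∉ lift v
  edge_inj : ∀ d d', ∀ b ∈ lift (src d), ∀ b' ∈ lift (src d'), ∀ t ∈ Ioo (0 : ℝ) 1,
    ∀ t' ∈ Ioo (0 : ℝ) 1, b + t * vec d = b' + t' * vec d' →
      (d' = d ∧ b' = b) ∨ (d' = rev d ∧ b' = b + vec d)

namespace PlanarDrawing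

variable {V D : Type*} (P : PlanarDrawing V D)

/-- The points of the drawing. -/
def graph : Set ℂ := {z | ∃ d, ∃ b ∈ P.lift (P.src d), ∃ t ∈ Icc (0 : ℝ) 1, z = b + t * P.vec d}

lemma vec_ne_zero (d : D) : P.vec d ≠ 0 := by
  obtain ⟨b, hb⟩ := P.lift_nonempty (P.src d)
  intro h
  exact P.edge_ne_vertex d b hb (1 / 2) (by norm_num) (P.src d) (by simpa [h] using hb)

variable {P}

lemma sub_vec_mem_lift {d : D} {p : ℂ} (hp : p ∈ P.lift (P.src (P.rev d))) :
    p - P.vec d ∈ P.lift (P.src d) := by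
  simpa only [P.rev_rev, P.vec_rev, ← sub_eq_add_neg] using P.add_vec_mem_lift (P.rev d) p hp

lemma mem_graph_of_mem_lift {v : V} {p : ℂ} (hp : p ∈ P.lift v) : p ∈ P.graph := by
  obtain ⟨d, rfl⟩ := P.exists_dart v
  exact ⟨d, p, hp, 0, by simp, by simp⟩

lemma exists_ball_disjoint_graph {p : ℂ} (hp : p ∉ P.graph) :
    ∃ ε > 0, Disjoint (Metric.ball p ε) P.graph := by
  obtain ⟨ε, hε, h⟩ := P.exists_ball p
  refine ⟨ε, hε, disjoint_left.2 ?_⟩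
  rintro _ hz ⟨d, b, hb, t, ht, rfl⟩
  obtain ⟨t₀, ht₀, h₀⟩ := h d b hb t ht hz
  exact hp ⟨d, b, hb, t₀, ht₀, h₀⟩

lemma exists_ball_edge {d : D} {b : ℂ} (hb : b ∈ P.lift (P.src d)) {τ : ℝ}
    (hτ : τ ∈ Ioo (0 : ℝ) 1) : ∃ ε > 0, ∀ z ∈ Metric.ball (b + τ * P.vec d) ε, z ∈ P.graph →
      ∃ t : ℝ, z = b + t * P.vec d := by
  obtain ⟨ε, hε, h⟩ := P.exists_ball (b + τ * P.vec d)
  refine ⟨ε, hε, ?_⟩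
  rintro _ hz ⟨d', b', hb', t, ht, rfl⟩
  obtain ⟨t₀, ht₀, h₀⟩ := h d' b' hb' t ht hz
  have hinner := P.edge_ne_vertex d b hb τ hτ
  rw [h₀] at hinner
  have ht0 : t₀ ≠ 0 := by
    rintro rfl
    exact hinner (P.src d') (by simpa using hb')
  have ht1 : t₀ ≠ 1 := by
    rintro rfl
    exact hinner (P.src (P.rev d')) (by simpa using P.add_vec_mem_lift d' b' hb')
  rcases P.edge_inj d d' b hb b' hb' τ hτ t₀
    ⟨ht₀.1.lt_of_ne' ht0, ht₀.2.lt_of_ne ht1⟩ h₀ with ⟨rfl, rfl⟩ | ⟨rfl, rfl⟩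
  · exact ⟨t, rfl⟩
  · refine ⟨1 - t, ?_⟩
    rw [P.vec_rev]
    push_cast
    ring

lemma exists_ball_vertex {v : V} {p : ℂ} (hp : p ∈ P.lift v) : ∃ ε > 0,
    ∀ z ∈ Metric.ball p ε, z ∈ P.graph → z ≠ p →
      ∃ d, P.src d = v ∧ ∃ t : ℝ, 0 < t ∧ z = p + t * P.vec d := by
  obtain ⟨ε, hε, h⟩ := P.exists_ball p
  refine ⟨ε, hε, ?_⟩
  rintro _ hz ⟨d, b, hb, t, ht, rfl⟩ hzp
  obtain ⟨t₀, ht₀, rfl⟩ := h d b hb t ht hz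
  rcases ht₀.1.eq_or_lt with rfl | ht0
  · simp only [ofReal_zero, zero_mul, add_zero] at hp hzp ⊢
    refine ⟨d, P.lift_inj _ _ b hb hp, t, ht.1.lt_of_ne ?_, rfl⟩
    rintro rfl
    simp at hzp
  rcases ht₀.2.eq_or_lt with rfl | ht1
  · simp only [ofReal_one, one_mul] at hp hzp ⊢
    refine ⟨P.rev d, P.lift_inj _ _ _ (P.add_vec_mem_lift d b hb) hp, 1 - t,
      sub_pos.2 (ht.2.lt_of_ne ?_), ?_⟩
    · rintro rfl
      simp at hzp
    · rw [P.vec_rev]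
      push_cast
      ring
  · exact absurd hp (P.edge_ne_vertex d b hb t₀ ⟨ht0, ht1⟩ v)

lemma eq_of_vec_eq {d d' : D} (h : P.src d = P.src d') {r : ℝ} (hr : 0 < r)
    (hv : P.vec d' = r * P.vec d) : d = d' := by
  obtain ⟨p, hp⟩ := P.lift_nonempty (P.src d)
  have hmeet : p + ((r / (2 * (1 + r)) : ℝ) : ℂ) * P.vec d =
      p + ((1 / (2 * (1 + r)) : ℝ) : ℂ) * P.vec d' := by
    rw [hv]
    push_cast
    ring
  have h1 : r / (2 * (1 + r)) < 1 := by rw [div_lt_one (by positivity)]; linarith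
  have h2 : 1 / (2 * (1 + r)) < 1 := by rw [div_lt_one (by positivity)]; linarith
  rcases P.edge_inj d d' p hp p (h ▸ hp) _ ⟨by positivity, h1⟩ _ ⟨by positivity, h2⟩ hmeet with
    ⟨h3, -⟩ | ⟨-, h3⟩
  · exact h3.symm
  · exact absurd (by simpa using h3) (P.vec_ne_zero d)

variable [Finite D]

variable (P) in
lemma exists_next (d : D) : ∃ y, P.src y = P.src (P.rev d) ∧ ∀ w, P.src w = P.src (P.rev d) →
    ccwAngle (P.vec y) (P.vec (P.rev d)) ≤ ccwAngle (P.vec w) (P.vec (P.rev d)) :=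
  Set.exists_min_image {y | P.src y = P.src (P.rev d)} _ (Set.toFinite _) ⟨P.rev d, rfl⟩

variable (P) in
/-- The dart following `d` on the boundary of the face to the left of `d`: the first one met when
turning clockwise, around the end of `d`, from the reverse of `d`. -/
def next (d : D) : D := (P.exists_next d).choose

variable (P) in
lemma src_next (d : D) : P.src (P.next d) = P.src (P.rev d) := (P.exists_next d).choose_spec.1

lemma ccwAngle_next_le {d w : D} (hw : P.src w = P.src (P.rev d)) :
    ccwAngle (P.vec (P.next d)) (P.vec (P.rev d)) ≤ ccwAngle (P.vec w) (P.vec (P.rev d)) :=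
  (P.exists_next d).choose_spec.2 w hw

lemma ccwAngle_next_rev_le {d w : D} (hw : P.src w = P.src (P.rev d)) :
    ccwAngle (P.vec (P.next d)) (P.vec (P.rev d)) ≤ ccwAngle (P.vec (P.next d)) (P.vec w) := by
  by_contra! hlt
  have hsub := ccwAngle_eq_sub_of_lt (P.vec_ne_zero _) (P.vec_ne_zero _) (P.vec_ne_zero w) hlt
  have hmin := ccwAngle_next_le hw
  have hpos := ccwAngle_pos (P.vec (P.next d)) (P.vec w)
  linarith

variable (P) in
lemma next_injective : Function.Injective P.next := by
  intro d d' h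
  have hsrc : P.src (P.rev d) = P.src (P.rev d') := by rw [← P.src_next, h, P.src_next]
  have hle := ccwAngle_next_rev_le hsrc.symm
  have hge := ccwAngle_next_rev_le hsrc
  rw [← h] at hge
  obtain ⟨r, hr, hvec⟩ := exists_pos_mul_of_ccwAngle_eq (P.vec_ne_zero _) (P.vec_ne_zero _)
    (P.vec_ne_zero _) (hle.antisymm hge)
  rw [← P.rev_rev d, eq_of_vec_eq hsrc hr hvec, P.rev_rev]

variable (P) in
/-- The sector between the end of `d` and the dart following `d`, at a point `p` over their common
vertex. -/
def corner (d : D) (p : ℂ) : Set ℂ := openSector p (P.vec (P.next d)) (P.vec (P.rev d))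

variable (P) in
/-- The vertical ray pointing up from the apex of the corner after `d` runs inside the corner. -/
def IsUpCorner (d : D) : Prop :=
  ccwAngle (P.vec (P.next d)) I < ccwAngle (P.vec (P.next d)) (P.vec (P.rev d))

lemma corner_disjoint_edge {d w : D} (hw : P.src w = P.src (P.rev d)) (p : ℂ) {t : ℝ}
    (ht : 0 < t) : p + t * P.vec w ∉ P.corner d p := by
  rintro ⟨-, hlt⟩
  rw [add_sub_cancel_left, ccwAngle_real_mul _ _ ht] at hlt
  exact hlt.not_ge (ccwAngle_next_rev_le hw)

lemma IsUpCorner.ccwAngle_next_le {d w : D} (h : P.IsUpCorner d)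
    (hw : P.src w = P.src (P.rev d)) :
    ccwAngle (P.vec (P.next d)) I ≤ ccwAngle (P.vec w) I := by
  have hsub := ccwAngle_eq_sub_add_two_pi_of_le (P.vec_ne_zero _) I_ne_zero (P.vec_ne_zero w)
    (h.le.trans (ccwAngle_next_rev_le hw))
  have hle := ccwAngle_le_two_pi (P.vec (P.next d)) (P.vec w)
  linarith

lemma IsUpCorner.eq_of_src_rev_eq {d d' : D} (h : P.IsUpCorner d) (h' : P.IsUpCorner d')
    (hsrc : P.src (P.rev d) = P.src (P.rev d')) : d = d' := by
  have hle := h.ccwAngle_next_le (w := P.next d') ((P.src_next d').trans hsrc.symm)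
  have hge := h'.ccwAngle_next_le (w := P.next d) ((P.src_next d).trans hsrc)
  obtain ⟨r, hr, hvec⟩ := exists_pos_mul_of_ccwAngle_left_eq (P.vec_ne_zero _) I_ne_zero
    (P.vec_ne_zero _) (hle.antisymm hge)
  refine P.next_injective (eq_of_vec_eq ?_ hr hvec)
  rw [P.src_next, P.src_next, hsrc]

lemma exists_isUpCorner (hre : ∀ d, (P.vec d).re ≠ 0) (v : V) :
    ∃ d, P.src (P.rev d) = v ∧ P.IsUpCorner d := by
  obtain ⟨y, hyv, hy⟩ := Set.exists_min_image {y | P.src y = v} (fun y => ccwAngle (P.vec y) I)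
    (Set.toFinite _) (P.exists_dart v)
  obtain ⟨d, rfl⟩ := (Finite.surjective_of_injective P.next_injective) y
  have hv : P.src (P.rev d) = v := (P.src_next d).symm.trans hyv
  refine ⟨d, hv, not_le.1 fun hle => ?_⟩
  rcases hle.lt_or_eq with hlt | heq
  · have hsub := ccwAngle_eq_sub_of_lt (P.vec_ne_zero _) I_ne_zero (P.vec_ne_zero _) hlt
    have hmin := hy (P.rev d) hv
    have hpos := ccwAngle_pos (P.vec (P.next d)) (P.vec (P.rev d))
    linarith
  · obtain ⟨r, hr, hI⟩ := exists_pos_mul_of_ccwAngle_eq (P.vec_ne_zero _) (P.vec_ne_zero _)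
      I_ne_zero heq
    have hzero : r * (P.vec (P.rev d)).re = 0 := by
      rw [← re_ofReal_mul, ← hI, I_re]
    exact (mul_ne_zero hr.ne' (hre _)) hzero

end PlanarDrawing

/-! ### A face of a drawing and its sides -/

/-- A face of a straight-line drawing none of whose edges is vertical and no two of whose vertices
lie on the same vertical line. The face is a simply connected component of the complement of
the drawing, contains no downward vertical ray, and is disjoint from its translates by the periods
of the drawing. -/
structure PlanarRegion (V D : Type*) extends PlanarDrawing V D where
  /-- the points of the face -/
  region : Set ℂ
  vec_re_ne : ∀ d, (vec d).re ≠ 0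
  re_inj : ∀ v w, ∀ p ∈ lift v, ∀ q ∈ lift w, p.re = q.re → p = q
  isSimplyConnected : IsSimplyConnected region
  disjoint_graph : Disjoint region toPlanarDrawing.graph
  maximal : ∀ C, IsPreconnected C → Disjoint C toPlanarDrawing.graph → (C ∩ region).Nonempty →
    C ⊆ region
  exists_notMem_below : ∀ z ∈ region, ∃ s : ℝ, 0 < s ∧ z - s * I ∉ region
  lift_unique : ∀ v, ∀ b ∈ lift v, ∀ b' ∈ lift v, ∀ z ∈ region, z + (b' - b) ∈ region → b = b'

namespace PlanarRegion

open PlanarDrawing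

variable {V D : Type*} {R : PlanarRegion V D}

lemma notMem_graph {z : ℂ} (hz : z ∈ R.region) : z ∉ R.graph :=
  disjoint_left.1 R.disjoint_graph hz

lemma isOpen_region : IsOpen R.region := by
  refine Metric.isOpen_iff.2 fun p hp => ?_
  obtain ⟨ε, hε, h⟩ := exists_ball_disjoint_graph (notMem_graph hp)
  exact ⟨ε, hε, R.maximal _ (convex_ball p ε).isPreconnected h ⟨p, Metric.mem_ball_self hε, hp⟩⟩

lemma isPreconnected_region : IsPreconnected R.region :=
  R.isSimplyConnected.isPathConnected.isConnected.isPreconnected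

lemma eventually_mem_or_eventually_notMem {s : Set ℂ} {p : ℂ} {ε : ℝ} (hε : 0 < ε)
    (hs : IsPreconnected (Metric.ball p ε ∩ s))
    (hdisj : Disjoint (Metric.ball p ε ∩ s) R.graph) :
    (∀ᶠ z in 𝓝[s] p, z ∈ R.region) ∨ ∀ᶠ z in 𝓝[s] p, z ∉ R.region := by
  have hmem : Metric.ball p ε ∩ s ∈ 𝓝[s] p :=
    inter_mem (mem_nhdsWithin_of_mem_nhds (Metric.ball_mem_nhds p hε)) self_mem_nhdsWithin
  by_cases hne : ((Metric.ball p ε ∩ s) ∩ R.region).Nonempty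
  · exact Or.inl (mem_of_superset hmem (R.maximal _ hs hdisj hne))
  · exact Or.inr (mem_of_superset hmem fun z hz hzR => hne ⟨z, hz, hzR⟩)

lemma eventually_leftHalfPlane_mem_or_notMem {d : D} {b : ℂ} (hb : b ∈ R.lift (R.src d)) {τ : ℝ}
    (hτ : τ ∈ Ioo (0 : ℝ) 1) :
    (∀ᶠ z in 𝓝[leftHalfPlane b (R.vec d)] (b + τ * R.vec d), z ∈ R.region) ∨
      ∀ᶠ z in 𝓝[leftHalfPlane b (R.vec d)] (b + τ * R.vec d), z ∉ R.region := by
  obtain ⟨ε, hε, h⟩ := exists_ball_edge hb hτ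
  refine eventually_mem_or_eventually_notMem hε
    ((convex_ball _ _).inter (convex_leftHalfPlane _ _)).isPreconnected (disjoint_left.2 ?_)
  rintro z ⟨hz, hleft⟩ hgraph
  obtain ⟨t, rfl⟩ := h z hz hgraph
  simp [add_mul_mem_leftHalfPlane_iff (R.vec_ne_zero d)] at hleft

/-- The dart over `d` starting at `b` has the face on its left. -/
def IsSide (R : PlanarRegion V D) (d : D) (b : ℂ) : Prop :=
  b ∈ R.lift (R.src d) ∧ ∀ τ ∈ Ioo (0 : ℝ) 1,
    ∀ᶠ z in 𝓝[leftHalfPlane b (R.vec d)] (b + τ * R.vec d), z ∈ R.region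

lemma isSide_of_frequently {d : D} {b : ℂ} (hb : b ∈ R.lift (R.src d)) {τ : ℝ}
    (hτ : τ ∈ Ioo (0 : ℝ) 1)
    (h : ∃ᶠ z in 𝓝[leftHalfPlane b (R.vec d)] (b + τ * R.vec d), z ∈ R.region) :
    R.IsSide d b := by
  have hopen (q : ℂ → Prop) :
      IsOpen {t : ℝ | ∀ᶠ z in 𝓝[leftHalfPlane b (R.vec d)] (b + t * R.vec d), q z} := by
    simp only [eventually_nhdsWithin_iff]
    exact (isOpen_setOfPred_eventually_nhds
      (p := fun z => z ∈ leftHalfPlane b (R.vec d) → q z)).preimage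
      (by fun_prop : Continuous fun t : ℝ => b + t * R.vec d)
  refine ⟨hb, fun t ht => isPreconnected_Ioo.subset_left_of_subset_union
    (hopen fun z => z ∈ R.region) (hopen fun z => z ∉ R.region) (disjoint_left.2 ?_)
    (fun t ht => eventually_leftHalfPlane_mem_or_notMem hb ht)
    ⟨τ, hτ, (eventually_leftHalfPlane_mem_or_notMem hb hτ).resolve_right h⟩ ht⟩
  intro t hin hout
  rw [mem_ofPred_eq] at hin hout
  have hneBot := (tendsto_add_mul_leftHalfPlane (R.vec_ne_zero d) b t).neBot
  obtain ⟨z, hz, hz'⟩ := (hin.and hout).exists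
  exact hz' hz

lemma IsSide.unique {d : D} {b b' : ℂ} (h : R.IsSide d b) (h' : R.IsSide d b') : b = b' := by
  have hmem {c : ℂ} (hc : R.IsSide d c) : ∀ᶠ s : ℝ in 𝓝[>] 0,
      c + ((1 / 2 : ℝ) + s * I) * R.vec d ∈ R.region :=
    (tendsto_add_mul_leftHalfPlane (R.vec_ne_zero d) c _).eventually (hc.2 (1 / 2) (by norm_num))
  obtain ⟨s, hs, hs'⟩ := ((hmem h).and (hmem h')).exists
  refine R.lift_unique _ b h.1 b' h'.1 _ hs ?_
  convert hs' using 1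
  ring

variable [Finite D]

lemma eventually_corner_mem_or_notMem {d : D} {p : ℂ} (hp : p ∈ R.lift (R.src (R.rev d))) :
    (∀ᶠ z in 𝓝[R.corner d p] p, z ∈ R.region) ∨ ∀ᶠ z in 𝓝[R.corner d p] p, z ∉ R.region := by
  obtain ⟨ε, hε, h⟩ := exists_ball_vertex hp
  refine eventually_mem_or_eventually_notMem hε
    (isPreconnected_ball_inter_openSector (R.vec_ne_zero _) p _ ε) (disjoint_left.2 ?_)
  rintro z ⟨hz, hcorner⟩ hgraph
  obtain ⟨w, hw, t, ht, rfl⟩ := h z hz hgraph hcorner.1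
  exact corner_disjoint_edge hw p ht hcorner

/-- The face fills the corner after `d`, at the point `p`. -/
def HasCorner (R : PlanarRegion V D) (d : D) (p : ℂ) : Prop :=
  ∀ᶠ z in 𝓝[R.corner d p] p, z ∈ R.region

lemma hasCorner_add_vec_iff {d : D} {b : ℂ} (hb : b ∈ R.lift (R.src d)) :
    R.HasCorner d (b + R.vec d) ↔ R.IsSide d b := by
  have hgerm (q : ℂ → Prop) (hq : ∀ᶠ z in 𝓝[R.corner d (b + R.vec d)] (b + R.vec d), q z) :
      ∃ τ ∈ Ioo (0 : ℝ) 1, ∃ᶠ z in 𝓝[leftHalfPlane b (R.vec d)] (b + τ * R.vec d), q z := by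
    rw [corner, R.vec_rev] at hq
    exact exists_frequently_of_eventually_openSector_second_side (R.vec_ne_zero _)
      (R.vec_ne_zero d) hq
  constructor
  · intro hcorner
    obtain ⟨τ, hτ, hq⟩ := hgerm _ hcorner
    exact isSide_of_frequently hb hτ hq
  · intro hside
    refine (eventually_corner_mem_or_notMem (R.add_vec_mem_lift d b hb)).resolve_right
      fun hout => ?_
    obtain ⟨τ, hτ, hq⟩ := hgerm _ hout
    exact hq ((hside.2 τ hτ).mono fun z hz hz' => hz' hz)

lemma hasCorner_iff_isSide_next {d : D} {p : ℂ} (hp : p ∈ R.lift (R.src (R.rev d))) :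
    R.HasCorner d p ↔ R.IsSide (R.next d) p := by
  constructor
  · intro hcorner
    obtain ⟨τ, hτ, hq⟩ := exists_frequently_of_eventually_openSector_first_side
      (R.vec_ne_zero _) hcorner
    exact isSide_of_frequently (by rwa [R.src_next]) hτ hq
  · intro hside
    refine (eventually_corner_mem_or_notMem hp).resolve_right fun hout => ?_
    obtain ⟨τ, hτ, hq⟩ := exists_frequently_of_eventually_openSector_first_side
      (R.vec_ne_zero _) hout
    exact hq ((hside.2 τ hτ).mono fun z hz hz' => hz' hz)

lemma IsSide.next {d : D} {b : ℂ} (h : R.IsSide d b) : R.IsSide (R.next d) (b + R.vec d) :=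
  (hasCorner_iff_isSide_next (R.add_vec_mem_lift d b h.1)).1 ((hasCorner_add_vec_iff h.1).2 h)

lemma HasCorner.isSide {d : D} {p : ℂ} (hp : p ∈ R.lift (R.src (R.rev d)))
    (h : R.HasCorner d p) : R.IsSide d (p - R.vec d) := by
  rw [← hasCorner_add_vec_iff (sub_vec_mem_lift hp), sub_add_cancel]
  exact h

lemma HasCorner.eventually_add_mul_I_mem {d : D} {p : ℂ} (h : R.HasCorner d p)
    (hup : R.IsUpCorner d) : ∀ᶠ s : ℝ in 𝓝[>] 0, p + s * I ∈ R.region :=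
  (tendsto_add_mul_I_openSector hup p).eventually h

lemma exists_hasCorner_of_frequently_add_mul_I_mem {v : V} {p : ℂ} (hp : p ∈ R.lift v)
    (h : ∃ᶠ s : ℝ in 𝓝[>] 0, p + s * I ∈ R.region) :
    ∃ d, R.src (R.rev d) = v ∧ R.IsUpCorner d ∧ R.HasCorner d p := by
  obtain ⟨d, rfl, hup⟩ := exists_isUpCorner R.vec_re_ne v
  exact ⟨d, rfl, hup, (eventually_corner_mem_or_notMem hp).resolve_right fun hout =>
    h ((tendsto_add_mul_I_openSector hup p).eventually hout)⟩

end PlanarRegion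

/-! ### Vertical strips above the sides -/

lemma eventually_forall_mem_imp_mem_of_isCompact {X Y M : Type*} [TopologicalSpace X]
    [TopologicalSpace Y] [TopologicalSpace M] {K : Set M} (hK : IsCompact K) {f : X × M → Y}
    (hf : Continuous f) {x₀ : X} {C U : Set Y}
    (h : ∀ m ∈ K, ∀ᶠ w in 𝓝[C] f (x₀, m), w ∈ U) :
    ∀ᶠ x in 𝓝 x₀, ∀ m ∈ K, f (x, m) ∈ C → f (x, m) ∈ U :=
  hK.eventually_forall_of_forall_eventually fun m hm =>
    hf.continuousAt.eventually (eventually_nhdsWithin_iff.1 (h m hm))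

/-- The vertical projection of `z` to the line through `b` with direction `v`. -/
def verticalProj (b v z : ℂ) : ℂ := b + ((z.re - b.re) / v.re : ℝ) * v

lemma continuous_verticalProj (b v : ℂ) : Continuous (verticalProj b v) := by
  unfold verticalProj
  fun_prop

lemma verticalProj_add_im_mul_I {b v : ℂ} (hv : v.re ≠ 0) (z : ℂ) :
    verticalProj b v z + ((z - verticalProj b v z).im : ℝ) * I = z := by
  apply Complex.ext <;> simp [verticalProj, hv]

lemma verticalProj_add_mul_add_mul_I {b v : ℂ} (hv : v.re ≠ 0) (t s : ℝ) :
    verticalProj b v (b + t * v + s * I) = b + t * v := by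
  simp [verticalProj, hv]

lemma add_mul_add_mul_I_mem_leftHalfPlane {v : ℂ} (hv : 0 < v.re) (b : ℂ) (t : ℝ) {s : ℝ}
    (hs : 0 < s) : b + t * v + s * I ∈ leftHalfPlane b v := by
  have hv0 : v ≠ 0 := by
    rintro rfl
    simp at hv
  rw [show b + t * v + s * I = b + (t + s * (I / v)) * v by field_simp; ring,
    add_mul_mem_leftHalfPlane_iff hv0, add_im, ofReal_im, im_ofReal_mul, zero_add]
  exact mul_pos hs ((im_div_pos_iff hv0).2 (by simpa using hv))

/-- The closed vertical ray going up from `p`. -/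
def upRay (p : ℂ) : Set ℂ := {z | z.re = p.re ∧ p.im ≤ z.im}

namespace PlanarRegion

open PlanarDrawing

variable {V D : Type*} {R : PlanarRegion V D}

/-- The point `z` is vertically above `p`, and the half-open segment from `p` to `z` is in the
face. -/
def IsFoot (R : PlanarRegion V D) (p z : ℂ) : Prop :=
  ∃ s > (0 : ℝ), z = p + s * I ∧ ∀ s' ∈ Ioc 0 s, p + s' * I ∈ R.region

lemma IsFoot.mem_region {p z : ℂ} (h : R.IsFoot p z) : z ∈ R.region := by
  obtain ⟨s, hs, rfl, hseg⟩ := h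
  exact hseg s ⟨hs, le_rfl⟩

lemma IsFoot.re_eq {p z : ℂ} (h : R.IsFoot p z) : z.re = p.re := by
  obtain ⟨s, -, rfl, -⟩ := h
  simp

lemma IsFoot.eventually_add_mul_I_mem {p z : ℂ} (h : R.IsFoot p z) :
    ∀ᶠ s : ℝ in 𝓝[>] 0, p + s * I ∈ R.region := by
  obtain ⟨s, hs, -, hseg⟩ := h
  filter_upwards [Ioc_mem_nhdsGT hs] with s' hs' using hseg s' hs'

lemma exists_isFoot_of_eventually {p : ℂ} (h : ∀ᶠ s : ℝ in 𝓝[>] 0, p + s * I ∈ R.region) :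
    ∃ z, R.IsFoot p z := by
  obtain ⟨s, hs, hseg⟩ := mem_nhdsGT_iff_exists_Ioc_subset.1 h
  exact ⟨_, s, hs, rfl, hseg⟩

lemma IsFoot.mem_region_of_between {p z w : ℂ} (h : R.IsFoot p z) (hw : w.re = p.re)
    (hpw : p.im < w.im) (hwz : w.im ≤ z.im) : w ∈ R.region := by
  obtain ⟨s, -, rfl, hseg⟩ := h
  have hmem := hseg (w.im - p.im) ⟨sub_pos.2 hpw, by simpa [add_comm] using hwz⟩
  rwa [show p + ((w.im - p.im : ℝ) : ℂ) * I = w by apply Complex.ext <;> simp [hw]] at hmem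

lemma IsFoot.unique {p q z : ℂ} (hp : p ∈ R.graph) (hq : q ∈ R.graph) (h : R.IsFoot p z)
    (h' : R.IsFoot q z) : p = q := by
  have hre : p.re = q.re := h.re_eq.symm.trans h'.re_eq
  have him {p z : ℂ} (h : R.IsFoot p z) : p.im ≤ z.im := by
    obtain ⟨s, hs, rfl, -⟩ := h
    simpa using hs.le
  rcases lt_trichotomy p.im q.im with hlt | heq | hlt
  · exact absurd hq (notMem_graph (h.mem_region_of_between hre.symm hlt (him h')))
  · exact Complex.ext hre heq
  · exact absurd hp (notMem_graph (h'.mem_region_of_between hre hlt (him h)))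

lemma exists_isFoot {z : ℂ} (hz : z ∈ R.region) : ∃ p ∈ R.graph, R.IsFoot p z := by
  obtain ⟨s₁, hs₁, hout⟩ := R.exists_notMem_below z hz
  let T : Set ℝ := Ici 0 ∩ (fun s : ℝ => z - s * I) ⁻¹' R.regionᶜ
  have hclosed : IsClosed T :=
    isClosed_Ici.inter (isOpen_region.isClosed_compl.preimage (by fun_prop))
  have hbdd : BddBelow T := ⟨0, fun s hs => hs.1⟩
  obtain ⟨s, hsT, hmin⟩ : ∃ s ∈ T, ∀ t ∈ T, s ≤ t :=
    ⟨sInf T, hclosed.csInf_mem ⟨s₁, hs₁.le, hout⟩ hbdd, fun t ht => csInf_le hbdd ht⟩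
  have hpos : 0 < s := hsT.1.lt_of_ne (by rintro rfl; exact hsT.2 (by simpa using hz))
  have hseg : ∀ s' ∈ Ioc 0 s, z - s * I + s' * I ∈ R.region := by
    intro s' hs'
    by_contra hcon
    have hle := hmin (s - s') ⟨sub_nonneg.2 hs'.2, by convert hcon using 2; push_cast; ring⟩
    linarith [hs'.1]
  refine ⟨z - s * I, ?_, s, hpos, by ring, hseg⟩
  by_contra hgraph
  obtain ⟨ε, hε, hball⟩ := exists_ball_disjoint_graph hgraph
  obtain ⟨s', hs', hmem⟩ := ((eventually_mem_set.2 (Ioc_mem_nhdsGT hpos)).and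
    ((tendsto_add_real_mul _ I).eventually (Metric.ball_mem_nhds (z - s * I) hε))).exists
  exact hsT.2 (R.maximal _ (convex_ball _ ε).isPreconnected hball ⟨_, hmem, hseg s' hs'⟩
    (Metric.mem_ball_self hε))

/-- The points of the face whose foot is an interior point of the edge `d`, for a dart `d` oriented
to the right, so that the face is above it. -/
def strip (R : PlanarRegion V D) (d : D) : Set ℂ :=
  {z | 0 < (R.vec d).re ∧ ∃ b ∈ R.lift (R.src d), ∃ τ ∈ Ioo (0 : ℝ) 1, R.IsFoot (b + τ * R.vec d) z}

lemma strip_subset_region (d : D) : R.strip d ⊆ R.region := by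
  rintro z ⟨-, b, -, τ, -, hfoot⟩
  exact hfoot.mem_region

lemma IsFoot.isSide {d : D} {b z : ℂ} (hd : 0 < (R.vec d).re) (hb : b ∈ R.lift (R.src d)) {τ : ℝ}
    (hτ : τ ∈ Ioo (0 : ℝ) 1) (h : R.IsFoot (b + τ * R.vec d) z) : R.IsSide d b := by
  refine isSide_of_frequently hb hτ (Tendsto.frequently
    (tendsto_nhdsWithin_of_tendsto_nhds_of_eventually_within _ (tendsto_add_real_mul _ I) ?_)
    h.eventually_add_mul_I_mem.frequently)
  filter_upwards [self_mem_nhdsWithin] with s hs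
  exact add_mul_add_mul_I_mem_leftHalfPlane hd b τ hs

lemma nonempty_strip_iff {d : D} :
    (R.strip d).Nonempty ↔ (∃ b, R.IsSide d b) ∧ 0 < (R.vec d).re := by
  constructor
  · rintro ⟨z, hd, b, hb, τ, hτ, hfoot⟩
    exact ⟨⟨b, hfoot.isSide hd hb hτ⟩, hd⟩
  · rintro ⟨⟨b, hb, hside⟩, hd⟩
    have hhalf := eventually_nhdsWithin_iff.1 (hside (1 / 2) (by norm_num))
    have hup : ∀ᶠ s : ℝ in 𝓝[>] 0,
        b + (1 / 2 : ℝ) * R.vec d + s * I ∈ R.region := by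
      filter_upwards [(tendsto_add_real_mul _ I).eventually hhalf, self_mem_nhdsWithin]
        with s hs hs0
      exact hs (add_mul_add_mul_I_mem_leftHalfPlane hd b _ hs0)
    obtain ⟨z, hz⟩ := exists_isFoot_of_eventually hup
    exact ⟨z, hd, b, hb, 1 / 2, by norm_num, hz⟩

lemma mem_graph_of_mem_Ioo {d : D} {b : ℂ} (hb : b ∈ R.lift (R.src d)) {τ : ℝ}
    (hτ : τ ∈ Ioo (0 : ℝ) 1) : b + τ * R.vec d ∈ R.graph :=
  ⟨d, b, hb, τ, Ioo_subset_Icc_self hτ, rfl⟩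

lemma eq_of_mem_strip {z : ℂ} {d d' : D} (h : z ∈ R.strip d) (h' : z ∈ R.strip d') : d = d' := by
  obtain ⟨hd, b, hb, τ, hτ, hfoot⟩ := h
  obtain ⟨hd', b', hb', τ', hτ', hfoot'⟩ := h'
  have heq := hfoot.unique (mem_graph_of_mem_Ioo hb hτ) (mem_graph_of_mem_Ioo hb' hτ') hfoot'
  rcases R.edge_inj d d' b hb b' hb' τ hτ τ' hτ' heq with ⟨rfl, -⟩ | ⟨rfl, -⟩
  · rfl
  · rw [R.vec_rev, neg_re] at hd'
    linarith

lemma exists_mem_strip_of_isFoot {d : D} {b z : ℂ} (hb : b ∈ R.lift (R.src d)) {τ : ℝ}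
    (hτ : τ ∈ Ioo (0 : ℝ) 1) (h : R.IsFoot (b + τ * R.vec d) z) : ∃ e, z ∈ R.strip e := by
  rcases (R.vec_re_ne d).lt_or_gt with hd | hd
  · refine ⟨R.rev d, by simpa [R.vec_rev] using hd, b + R.vec d, R.add_vec_mem_lift d b hb, 1 - τ,
      ⟨by linarith [hτ.2], by linarith [hτ.1]⟩, ?_⟩
    convert h using 1
    rw [R.vec_rev]
    push_cast
    ring
  · exact ⟨d, hd, b, hb, τ, hτ, h⟩

lemma exists_mem_strip_or_isFoot_vertex {z : ℂ} (hz : z ∈ R.region) :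
    (∃ d, z ∈ R.strip d) ∨ ∃ v, ∃ p ∈ R.lift v, R.IsFoot p z := by
  obtain ⟨_, ⟨d, b, hb, t, ht, rfl⟩, hfoot⟩ := exists_isFoot hz
  rcases ht.1.eq_or_lt with rfl | h0
  · exact Or.inr ⟨_, _, by simpa using hb, hfoot⟩
  rcases ht.2.eq_or_lt with rfl | h1
  · exact Or.inr ⟨_, _, by simpa using R.add_vec_mem_lift d b hb, hfoot⟩
  · exact Or.inl (exists_mem_strip_of_isFoot hb ⟨h0, h1⟩ hfoot)

lemma mem_strip_of_sub_mul_I_mem_strip {z : ℂ} {d : D} {s : ℝ} (hs : 0 ≤ s)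
    (h : z - s * I ∈ R.strip d) (hseg : ∀ r ∈ Icc 0 s, z - r * I ∈ R.region) : z ∈ R.strip d := by
  obtain ⟨hd, b, hb, τ, hτ, s₁, hs₁, heq, hlow⟩ := h
  refine ⟨hd, b, hb, τ, hτ, s₁ + s, by positivity, ?_, fun s' hs' => ?_⟩
  · push_cast
    linear_combination heq
  · rcases le_or_gt s' s₁ with hle | hlt
    · exact hlow s' ⟨hs'.1, hle⟩
    · convert hseg (s₁ + s - s') ⟨by linarith [hs'.2], by linarith⟩ using 1
      push_cast
      linear_combination -heq

lemma eventually_mem_strip {d : D} (hd : 0 < (R.vec d).re) {b z₀ : ℂ}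
    (hb : b ∈ R.lift (R.src d)) {τ : ℝ} (hfoot : R.IsFoot (b + τ * R.vec d) z₀) {C : Set ℂ}
    (hC : ∀ᶠ w in 𝓝[C] (b + τ * R.vec d), w ∈ R.region) :
    ∀ᶠ z in 𝓝 z₀, (z.re - b.re) / (R.vec d).re ∈ Ioo (0 : ℝ) 1 →
      (∀ s : ℝ, 0 < s → verticalProj b (R.vec d) z + s * I ∈ C) → z ∈ R.strip d := by
  obtain ⟨s₀, hs₀, rfl, hseg⟩ := hfoot
  set z₀ := b + τ * R.vec d + s₀ * I
  let height (z : ℂ) : ℝ := (z - verticalProj b (R.vec d) z).im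
  have hproj := continuous_verticalProj b (R.vec d)
  have hproj₀ : verticalProj b (R.vec d) z₀ = b + τ * R.vec d :=
    verticalProj_add_mul_add_mul_I hd.ne' τ s₀
  have hheight₀ : height z₀ = s₀ := by simp [height, hproj₀, z₀]
  have hheight : ∀ᶠ z in 𝓝 z₀, 0 < height z :=
    (by fun_prop : Continuous height).continuousAt.eventually_const_lt (by rwa [hheight₀])
  have htube := eventually_forall_mem_imp_mem_of_isCompact isCompact_Icc (K := Icc (0 : ℝ) 1)
    (f := fun x : ℂ × ℝ => verticalProj b (R.vec d) x.1 + ((x.2 * height x.1 : ℝ) : ℂ) * I)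
    (by fun_prop) (x₀ := z₀) (C := C) (U := R.region) fun m hm => by
      simp only [hproj₀, hheight₀]
      rcases hm.1.eq_or_lt with rfl | hm0
      · simpa using hC
      · exact mem_nhdsWithin_of_mem_nhds (isOpen_region.mem_nhds
          (hseg _ ⟨by positivity, mul_le_of_le_one_left hs₀.le hm.2⟩))
  filter_upwards [htube, hheight] with z hz hpos hIoo hzC
  refine ⟨hd, b, hb, _, hIoo, height z, hpos, (verticalProj_add_im_mul_I hd.ne' z).symm,
    fun s hs => ?_⟩
  have hmem := hz (s / height z) ⟨by have := hs.1; positivity, (div_le_one hpos).2 hs.2⟩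
  simp only [div_mul_cancel₀ s hpos.ne'] at hmem
  exact hmem (hzC s hs.1)

lemma isOpen_strip (d : D) : IsOpen (R.strip d) := by
  refine isOpen_iff_mem_nhds.2 fun z₀ hz₀ => ?_
  obtain ⟨hd, b, hb, τ, hτ, hfoot⟩ := hz₀
  have hIoo : ∀ᶠ z : ℂ in 𝓝 z₀, (z.re - b.re) / (R.vec d).re ∈ Ioo (0 : ℝ) 1 := by
    refine (by fun_prop : Continuous fun z : ℂ => (z.re - b.re) / (R.vec d).re).continuousAt
      (isOpen_Ioo.mem_nhds ?_)
    simpa [hfoot.re_eq, hd.ne'] using hτ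
  filter_upwards [hIoo, eventually_mem_strip hd hb hfoot ((hfoot.isSide hd hb hτ).2 τ hτ)] with
    z hz hmem
  exact hmem hz fun s hs => add_mul_add_mul_I_mem_leftHalfPlane hd b _ hs

lemma exists_mem_strip_below {v : V} {p : ℂ} (hp : p ∈ R.lift v)
    (hdown : ∀ᶠ s : ℝ in 𝓝[>] 0, p - s * I ∈ R.region) :
    ∃ η > (0 : ℝ), (∀ s ∈ Ioc 0 η, p - s * I ∈ R.region) ∧ ∃ e, p - η * I ∈ R.strip e := by
  obtain ⟨η, hη, hseg⟩ := mem_nhdsGT_iff_exists_Ioc_subset.1 hdown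
  refine ⟨η, hη, hseg, (exists_mem_strip_or_isFoot_vertex (hseg ⟨hη, le_rfl⟩)).resolve_right ?_⟩
  rintro ⟨w, q, hq, hfoot⟩
  obtain rfl : q = p := R.re_inj w v q hq p hp (by simpa using hfoot.re_eq.symm)
  obtain ⟨s, hs, heq, -⟩ := hfoot
  have him := congrArg Complex.im heq
  simp only [sub_im, mul_im, ofReal_re, I_im, mul_one, ofReal_im, I_re, mul_zero, add_zero,
    add_im] at him
  linarith [mem_Ioi.1 hη]

lemma eventually_mem_strip_of_mem_strip_below {p z₀ : ℂ} {e : D} {η : ℝ} (hη : 0 < η)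
    (hseg : ∀ s ∈ Ioc 0 η, p - s * I ∈ R.region) (he : p - η * I ∈ R.strip e)
    (hfoot : R.IsFoot p z₀) {C : Set ℂ} (hC : ∀ᶠ w in 𝓝[C] p, w ∈ R.region)
    (hvert : ∀ z ∈ C, ∀ s : ℝ, z - s * I ∈ C) : ∀ᶠ z in 𝓝 z₀, z ∈ C → z ∈ R.strip e := by
  obtain ⟨s₀, hs₀, rfl, hup⟩ := hfoot
  have htube := eventually_forall_mem_imp_mem_of_isCompact isCompact_Icc (K := Icc (0 : ℝ) (s₀ + η))
    (f := fun x : ℂ × ℝ => x.1 - x.2 * I) (by fun_prop) (x₀ := p + s₀ * I) (C := C)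
    (U := R.region) fun m hm => by
      have hmem {w : ℂ} (hw : w ∈ R.region) (heq : p + s₀ * I - m * I = w) :
          ∀ᶠ w in 𝓝[C] (p + s₀ * I - m * I), w ∈ R.region :=
        mem_nhdsWithin_of_mem_nhds (isOpen_region.mem_nhds (heq ▸ hw))
      rcases lt_trichotomy m s₀ with hlt | rfl | hlt
      · exact hmem (hup (s₀ - m) ⟨by linarith, by linarith [hm.1]⟩) (by push_cast; ring)
      · simpa using hC
      · exact hmem (hseg (m - s₀) ⟨by linarith, by linarith [hm.2]⟩) (by push_cast; ring)
  have hlow : ∀ᶠ z in 𝓝 (p + s₀ * I), z - ((s₀ + η : ℝ) : ℂ) * I ∈ R.strip e := by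
    refine (by fun_prop : Continuous fun z : ℂ => z - ((s₀ + η : ℝ) : ℂ) * I).continuousAt
      ((isOpen_strip e).mem_nhds ?_)
    convert he using 1
    push_cast
    ring
  filter_upwards [htube, hlow] with z hz hzlow hzC
  exact mem_strip_of_sub_mul_I_mem_strip (by positivity) hzlow
    fun r hr => hz r hr (hvert z hzC r)

lemma eventually_re_div_mem_Ioo {v p z₀ : ℂ} (hz₀ : z₀.re = p.re) :
    ∀ᶠ z : ℂ in 𝓝 z₀, 0 < (z.re - p.re) / v.re → (z.re - p.re) / v.re ∈ Ioo (0 : ℝ) 1 := by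
  have hlim : Tendsto (fun z : ℂ => (z.re - p.re) / v.re) (𝓝 z₀) (𝓝 0) :=
    Continuous.tendsto' (by fun_prop) _ _ (by simp [hz₀])
  filter_upwards [hlim.eventually_lt_const one_pos] with z hlt hpos using ⟨hpos, hlt⟩

section Disjoint

variable {p : ℂ} {e : D}

lemma disjoint_strip_upRay_of_mem_strip_below (hp : p ∈ R.graph) {q : ℂ} (hq : q ∈ R.strip e)
    (hre : q.re = p.re) (him : q.im < p.im) : Disjoint (R.strip e) (upRay p) := by
  refine disjoint_left.2 ?_
  rintro z ⟨hd, b, hb, τ, hτ, hfoot⟩ ⟨hzre, hzim⟩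
  obtain ⟨-, b', hb', τ', hτ', hfoot'⟩ := hq
  obtain rfl := (hfoot.isSide hd hb hτ).unique (hfoot'.isSide hd hb' hτ')
  have hτeq : τ = τ' := by
    have heq := hfoot.re_eq.symm.trans (hzre.trans (hre.symm.trans hfoot'.re_eq))
    simpa [hd.ne'] using heq
  subst hτeq
  refine notMem_graph (hfoot.mem_region_of_between (hzre.symm.trans hfoot.re_eq) ?_ hzim) hp
  obtain ⟨s, hs, rfl, -⟩ := hfoot'
  refine lt_trans ?_ him
  simpa using hs

lemma disjoint_strip_upRay_of_isSide (h : R.IsSide e p) : Disjoint (R.strip e) (upRay p) := by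
  refine disjoint_left.2 ?_
  rintro z ⟨hd, b, hb, τ, hτ, hfoot⟩ ⟨hzre, -⟩
  obtain rfl := (hfoot.isSide hd hb hτ).unique h
  have hzero : τ * (R.vec e).re = 0 := by simpa using hfoot.re_eq.symm.trans hzre
  exact (mul_pos hτ.1 hd).ne' hzero

end Disjoint

section Corner

variable [Finite D] {d : D} {p : ℂ}

lemma exists_strip_of_corner_below (hp : p ∈ R.lift (R.src (R.rev d))) (hcor : R.HasCorner d p)
    {C : Set ℂ} (hC : C ⊆ R.corner d p) (hvert : ∀ z ∈ C, ∀ s : ℝ, z - s * I ∈ C)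
    (hdown : ∀ s : ℝ, 0 < s → p - s * I ∈ R.corner d p) :
    ∃ e, Disjoint (R.strip e) (upRay p) ∧
      ∀ z₀, R.IsFoot p z₀ → ∀ᶠ z in 𝓝 z₀, z ∈ C → z ∈ R.strip e := by
  have hbelow : ∀ᶠ s : ℝ in 𝓝[>] 0, p - s * I ∈ R.region := by
    refine Tendsto.eventually (tendsto_nhdsWithin_of_tendsto_nhds_of_eventually_within _ ?_
      (by filter_upwards [self_mem_nhdsWithin] with s hs using hdown s hs)) hcor
    simpa only [mul_neg, ← sub_eq_add_neg] using tendsto_add_real_mul p (-I)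
  obtain ⟨η, hη, hseg, e, he⟩ := exists_mem_strip_below hp hbelow
  exact ⟨e, disjoint_strip_upRay_of_mem_strip_below (mem_graph_of_mem_lift hp) he (by simp)
    (by simpa using hη), fun z₀ hz₀ => eventually_mem_strip_of_mem_strip_below hη hseg he hz₀
      (hcor.filter_mono (nhdsWithin_mono _ hC)) hvert⟩

lemma exists_strip_right_of_corner (hup : R.IsUpCorner d) (hp : p ∈ R.lift (R.src (R.rev d)))
    (hcor : R.HasCorner d p) : ∃ e, Disjoint (R.strip e) (upRay p) ∧
      ∀ z₀, R.IsFoot p z₀ → ∀ᶠ z in 𝓝 z₀, p.re < z.re → z ∈ R.strip e := by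
  rcases (R.vec_re_ne (R.next d)).lt_or_gt with hre | hre
  · have hsub (z : ℂ) (hz : 0 < (z - p).re ∨ (z - p).re = 0 ∧ (z - p).im < 0) :
        z ∈ R.corner d p :=
      ⟨by rintro rfl; simp at hz, (ccwAngle_lt_of_re_neg hre hz).trans hup⟩
    exact exists_strip_of_corner_below hp hcor (C := {z | p.re < z.re})
      (fun z hz => hsub z (Or.inl (by simpa using hz))) (fun z hz s => by simpa using hz)
      fun s hs => hsub _ (Or.inr (by simpa using hs))
  · have hside := (hasCorner_iff_isSide_next hp).1 hcor
    refine ⟨R.next d, disjoint_strip_upRay_of_isSide hside, fun z₀ hz₀ => ?_⟩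
    filter_upwards [eventually_mem_strip hre hside.1 (τ := 0) (by simpa using hz₀)
      (by simpa [HasCorner] using hcor),
      eventually_re_div_mem_Ioo (v := R.vec (R.next d)) hz₀.re_eq]
      with z hstrip hIoo hz
    have hpos : 0 < (z.re - p.re) / (R.vec (R.next d)).re := div_pos (sub_pos.2 hz) hre
    refine hstrip (hIoo hpos) fun s hs => ⟨?_, ?_⟩
    · refine ne_of_apply_ne re ?_
      simpa [verticalProj, hre.ne', sub_eq_zero] using hz.ne'
    · rw [show verticalProj p (R.vec (R.next d)) z + s * I - p =
        ((z.re - p.re) / (R.vec (R.next d)).re : ℝ) * R.vec (R.next d) + s * I by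
          rw [verticalProj]; ring]
      exact (ccwAngle_lt_of_mem_cone_right hre hpos hs).trans hup

lemma mem_corner_of_ccwAngle_I_lt (hup : R.IsUpCorner d) {z : ℂ} (hz : z ≠ p)
    (h : ccwAngle I (z - p) < ccwAngle I (R.vec (R.rev d))) : z ∈ R.corner d p := by
  have hsplit := ccwAngle_eq_sub_of_lt (R.vec_ne_zero (R.next d)) (R.vec_ne_zero (R.rev d))
    I_ne_zero hup
  have hle := ccwAngle_le_two_pi (R.vec (R.next d)) (R.vec (R.rev d))
  refine ⟨hz, ?_⟩
  rw [ccwAngle_eq_add_of_add_le (R.vec_ne_zero _) (sub_ne_zero.2 hz) I_ne_zero (by linarith)]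
  linarith

lemma exists_strip_left_of_corner (hup : R.IsUpCorner d) (hp : p ∈ R.lift (R.src (R.rev d)))
    (hcor : R.HasCorner d p) :
    ∃ e, ∀ z₀, R.IsFoot p z₀ → ∀ᶠ z in 𝓝 z₀, z.re < p.re → z ∈ R.strip e := by
  have hrev : (R.vec (R.rev d)).re = -(R.vec d).re := by rw [R.vec_rev, neg_re]
  rcases (R.vec_re_ne d).lt_or_gt with hre | hre
  · have hsub (z : ℂ) (hz : (z - p).re < 0 ∨ (z - p).re = 0 ∧ (z - p).im < 0) :
        z ∈ R.corner d p :=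
      mem_corner_of_ccwAngle_I_lt hup (by rintro rfl; simp at hz)
        (ccwAngle_lt_of_re_pos (by rw [hrev]; linarith) hz)
    obtain ⟨e, -, he⟩ := exists_strip_of_corner_below hp hcor (C := {z | z.re < p.re})
      (fun z hz => hsub z (Or.inl (by simpa using hz))) (fun z hz s => by simpa using hz)
      fun s hs => hsub _ (Or.inr (by simpa using hs))
    exact ⟨e, he⟩
  · refine ⟨d, fun z₀ hz₀ => ?_⟩
    filter_upwards [eventually_mem_strip hre (sub_vec_mem_lift hp) (τ := 1) (by simpa using hz₀)
      (by simpa [HasCorner] using hcor), eventually_re_div_mem_Ioo (v := R.vec (R.rev d)) hz₀.re_eq]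
      with z hstrip hIoo hz
    rw [hrev] at hIoo
    set r := (z.re - p.re) / -(R.vec d).re with hr
    have hpos : 0 < r := div_pos_of_neg_of_neg (sub_neg.2 hz) (neg_neg_iff_pos.2 hre)
    have hτ : (z.re - (p - R.vec d).re) / (R.vec d).re = 1 - r := by
      rw [sub_re, hr]
      field_simp
      ring
    refine hstrip (by rw [hτ]; exact ⟨by linarith [(hIoo hpos).2], by linarith⟩) fun s hs =>
      mem_corner_of_ccwAngle_I_lt hup ?_ ?_
    · refine ne_of_apply_ne re ?_
      simpa [verticalProj, hre.ne', sub_eq_zero] using hz.ne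
    · rw [show verticalProj (p - R.vec d) (R.vec d) z + s * I - p =
        (r : ℂ) * R.vec (R.rev d) + s * I by
          rw [verticalProj, hτ, R.vec_rev]; push_cast; ring]
      exact ccwAngle_lt_of_mem_cone_left (by rw [hrev]; linarith) hpos hs

end Corner

lemma eventually_forall_uIcc_mem_region {d : D} {b : ℂ} (hd : 0 < (R.vec d).re)
    (hside : R.IsSide d b) {τ₁ τ₂ : ℝ} (hτ₁ : τ₁ ∈ Ioo (0 : ℝ) 1) (hτ₂ : τ₂ ∈ Ioo (0 : ℝ) 1) :
    ∀ᶠ s : ℝ in 𝓝[>] 0, ∀ τ ∈ uIcc τ₁ τ₂, b + τ * R.vec d + s * I ∈ R.region := by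
  have htube := eventually_forall_mem_imp_mem_of_isCompact isCompact_uIcc (K := uIcc τ₁ τ₂)
    (f := fun x : ℝ × ℝ => b + x.2 * R.vec d + x.1 * I) (by fun_prop) (x₀ := 0)
    (C := leftHalfPlane b (R.vec d)) (U := R.region) fun τ hτ => by
      simpa using hside.2 τ (ordConnected_Ioo.uIcc_subset hτ₁ hτ₂ hτ)
  filter_upwards [nhdsWithin_le_nhds htube, self_mem_nhdsWithin] with s hs hpos τ hτ
  exact hs τ hτ (add_mul_add_mul_I_mem_leftHalfPlane hd b τ hpos)

lemma isPreconnected_strip_inter_re_preimage (d : D) {J : Set ℝ} (hJ : J.OrdConnected) :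
    IsPreconnected (R.strip d ∩ re ⁻¹' J) := by
  refine isPreconnected_of_forall_pair ?_
  rintro x ⟨⟨hd, b, hb, τ₁, hτ₁, hfoot₁⟩, hxJ⟩ y ⟨⟨-, b', hb', τ₂, hτ₂, hfoot₂⟩, hyJ⟩
  have hside := hfoot₁.isSide hd hb hτ₁
  obtain rfl := hside.unique (hfoot₂.isSide hd hb' hτ₂)
  obtain ⟨s₁, hs₁, rfl, hseg₁⟩ := hfoot₁
  obtain ⟨s₂, hs₂, rfl, hseg₂⟩ := hfoot₂
  obtain ⟨ε, hε, hlow⟩ := mem_nhdsGT_iff_exists_Ioc_subset.1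
    (eventually_forall_uIcc_mem_region hd hside hτ₁ hτ₂)
  have hre {τ : ℝ} (hτ : τ ∈ uIcc τ₁ τ₂) (s : ℝ) : (b + τ * R.vec d + s * I).re ∈ J := by
    have hmono : Monotone fun τ : ℝ => b.re + τ * (R.vec d).re :=
      fun _ _ h => add_le_add_right (mul_le_mul_of_nonneg_right h hd.le) _
    refine hJ.uIcc_subset hxJ hyJ ?_
    simpa using hmono.mapsTo_uIcc hτ
  have hvert {τ : ℝ} (hτ : τ ∈ uIcc τ₁ τ₂) {s₀ : ℝ} (hs₀ : 0 < s₀)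
      (hseg : ∀ s ∈ Ioc 0 s₀, b + τ * R.vec d + s * I ∈ R.region) {s : ℝ} (hs : s ∈ uIcc ε s₀) :
      b + τ * R.vec d + s * I ∈ R.strip d ∩ re ⁻¹' J := by
    refine ⟨⟨hd, b, hb, τ, ordConnected_Ioo.uIcc_subset hτ₁ hτ₂ hτ, s,
      (lt_min hε hs₀).trans_le hs.1, rfl, fun s' hs' => ?_⟩, hre hτ s⟩
    rcases le_max_iff.1 (hs'.2.trans hs.2) with hle | hle
    · exact hlow ⟨hs'.1, hle⟩ τ hτ
    · exact hseg s' ⟨hs'.1, hle⟩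
  have hpath (τ s₀ : ℝ) :
      IsPreconnected ((fun s : ℝ => b + τ * R.vec d + s * I) '' uIcc ε s₀) :=
    isPreconnected_uIcc.image _ (by fun_prop)
  refine ⟨(fun s : ℝ => b + τ₁ * R.vec d + s * I) '' uIcc ε s₁ ∪
    ((fun τ : ℝ => b + τ * R.vec d + ε * I) '' uIcc τ₁ τ₂ ∪
    (fun s : ℝ => b + τ₂ * R.vec d + s * I) '' uIcc ε s₂), ?_, ?_, ?_, ?_⟩
  · rintro _ (⟨s, hs, rfl⟩ | ⟨τ, hτ, rfl⟩ | ⟨s, hs, rfl⟩)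
    · exact hvert left_mem_uIcc hs₁ hseg₁ hs
    · exact hvert hτ hε (fun s hs => hlow hs τ hτ) left_mem_uIcc
    · exact hvert right_mem_uIcc hs₂ hseg₂ hs
  · exact Or.inl ⟨s₁, right_mem_uIcc, rfl⟩
  · exact Or.inr (Or.inr ⟨s₂, right_mem_uIcc, rfl⟩)
  · exact (hpath τ₁ s₁).union _ ⟨ε, left_mem_uIcc, rfl⟩ (Or.inl ⟨τ₁, left_mem_uIcc, rfl⟩)
      ((isPreconnected_uIcc.image _ (by fun_prop)).union _ ⟨τ₂, right_mem_uIcc, rfl⟩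
        ⟨ε, left_mem_uIcc, rfl⟩ (hpath τ₂ s₂))

end PlanarRegion

/-! ### Counting the strips of a face -/

lemma I_pow_mul_neg_I_pow_mul_neg_one_pow {u n m : ℕ} (h : u + 1 + n = 2 * m) :
    I ^ (u + 1) * (-I) ^ n * (-1) ^ u = (-1) ^ (m + 1) := by
  have hodd : Odd (n + u) := ⟨m - 1, by omega⟩
  calc I ^ (u + 1) * (-I) ^ n * (-1) ^ u
      = I ^ (u + 1 + n) * (-1) ^ (n + u) := by
        rw [neg_pow, pow_add I (u + 1), pow_add (-1 : ℂ)]; ring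
    _ = (-1) ^ (m + 1) := by rw [h, pow_mul, I_sq, hodd.neg_one_pow, pow_succ]

lemma eq_of_eventually_eq_of_isPreconnected {X Y : Type*} [TopologicalSpace X] {S : Set X}
    (hS : IsPreconnected S) {f : X → Y} (h : ∀ x ∈ S, ∀ᶠ y in 𝓝[S] x, f y = f x) {x y : X}
    (hx : x ∈ S) (hy : y ∈ S) : f x = f y := by
  let _ : TopologicalSpace Y := ⊥
  have : DiscreteTopology Y := ⟨rfl⟩
  have hcont : ContinuousOn f S := fun z hz => by
    rw [ContinuousWithinAt, nhds_discrete, tendsto_pure]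
    exact h z hz
  exact (hS.image f hcont).subsingleton (mem_image_of_mem f hx) (mem_image_of_mem f hy)

lemma surjective_of_triangular {𝕜 E U κ : Type*} [Field 𝕜] [AddCommGroup E] [Module 𝕜 E]
    [Finite U] [LinearOrder κ] (L : E →ₗ[𝕜] (U → 𝕜)) {key : U → κ} (hkey : Function.Injective key)
    (h : ∀ c, ∃ x, L x c ≠ 0 ∧ ∀ c', key c' < key c → L x c' = 0) : Function.Surjective L := by
  classical
  have := Fintype.ofFinite U
  rw [← LinearMap.range_eq_top]
  by_contra hne
  obtain ⟨f, hf, hle⟩ := Submodule.exists_le_ker_of_lt_top _ (lt_top_iff_ne_top.2 hne)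
  have hsum (g : U → 𝕜) : f g = ∑ c, g c * f (Pi.single c 1) := by
    conv_lhs => rw [pi_eq_sum_univ' g]
    simp only [map_sum, map_smul, smul_eq_mul]
  have hex : ∃ c, f (Pi.single c 1) ≠ 0 := by
    by_contra! hcon
    exact hf (LinearMap.ext fun g => by rw [hsum]; simp [hcon])
  obtain ⟨c, hc, hmax⟩ := Set.exists_max_image {c | f (Pi.single c 1) ≠ 0} key (Set.toFinite _) hex
  obtain ⟨x, hx, hx'⟩ := h c
  have hzero : f (L x) = 0 := hle ⟨x, rfl⟩
  rw [hsum, Finset.sum_eq_single c (fun c' _ hcc => ?_) (by simp)] at hzero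
  · exact mul_ne_zero hx hc hzero
  · by_cases hc' : f (Pi.single c' 1) = 0
    · rw [hc', mul_zero]
    · rw [hx' c' ((hmax c' hc').lt_of_ne fun heq => hcc (hkey heq)), zero_mul]

-- The pairs `(l c, r c)` are the edges of a tree with vertex set `F`: the difference operator
-- across the edges has the constants as kernel, and it is onto.
lemma card_eq_card_add_one_of_cuts {F U κ : Type*} [Finite F] [Nonempty F] [Finite U]
    [LinearOrder κ] (l r : U → F)
    (hconst : ∀ a : F → ℝ, (∀ c, a (l c) = a (r c)) → ∀ d d', a d = a d')
    {key : U → κ} (hkey : Function.Injective key)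
    (hjump : ∀ c, ∃ a : F → ℝ, a (l c) ≠ a (r c) ∧ ∀ c', key c' < key c → a (l c') = a (r c')) :
    Nat.card F = Nat.card U + 1 := by
  have := Fintype.ofFinite F
  have := Fintype.ofFinite U
  let L : (F → ℝ) →ₗ[ℝ] (U → ℝ) := LinearMap.funLeft ℝ ℝ l - LinearMap.funLeft ℝ ℝ r
  have hL (a : F → ℝ) (c : U) : L a c = a (l c) - a (r c) := rfl
  have hker : LinearMap.ker L = Submodule.span ℝ {fun _ => (1 : ℝ)} := by
    ext a
    rw [LinearMap.mem_ker, Submodule.mem_span_singleton]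
    constructor
    · intro ha
      obtain ⟨d₀⟩ := ‹Nonempty F›
      refine ⟨a d₀, funext fun d => ?_⟩
      simpa using hconst a (fun c => sub_eq_zero.1 ((hL a c).symm.trans (congrFun ha c))) d₀ d
    · rintro ⟨t, rfl⟩
      ext c
      simp [hL]
  have hone : (fun _ => 1 : F → ℝ) ≠ 0 := fun h => one_ne_zero (congrFun h (Classical.arbitrary F))
  have hsurj : Function.Surjective L := surjective_of_triangular L hkey fun c => by
    obtain ⟨a, hne, heq⟩ := hjump c
    exact ⟨a, sub_ne_zero.2 hne, fun c' hc' => sub_eq_zero.2 (heq c' hc')⟩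
  have hrank := L.finrank_range_add_finrank_ker
  rw [LinearMap.range_eq_top.2 hsurj, finrank_top, hker, finrank_span_singleton hone,
    Module.finrank_fintype_fun_eq_card, Module.finrank_fintype_fun_eq_card] at hrank
  rw [Nat.card_eq_fintype_card, Nat.card_eq_fintype_card, hrank]

lemma frequently_re_gt (z₀ : ℂ) : ∃ᶠ z : ℂ in 𝓝 z₀, z₀.re < z.re := by
  refine (tendsto_add_real_mul z₀ 1).frequently (Eventually.frequently ?_)
  filter_upwards [self_mem_nhdsWithin] with s hs
  simpa using hs

lemma frequently_re_lt (z₀ : ℂ) : ∃ᶠ z : ℂ in 𝓝 z₀, z.re < z₀.re := by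
  refine (tendsto_add_real_mul z₀ (-1)).frequently (Eventually.frequently ?_)
  filter_upwards [self_mem_nhdsWithin] with s hs
  simpa using hs

lemma frequently_re_ne_and_ne (t : ℝ) (z₀ : ℂ) : ∃ᶠ z : ℂ in 𝓝 z₀, z.re ≠ t ∧ z.re ≠ z₀.re := by
  rcases le_or_gt t z₀.re with h | h
  · exact (frequently_re_gt z₀).mono fun z hz => ⟨(h.trans_lt hz).ne', hz.ne'⟩
  · exact (frequently_re_lt z₀).mono fun z hz => ⟨(hz.trans h).ne, hz.ne⟩

lemma exists_continuousOn_angle {U : Set ℂ} (hU : IsOpen U) (hsc : IsSimplyConnected U) {p : ℂ}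
    (hp : p ∉ U) :
    ∃ A : ℂ → ℝ, ContinuousOn A U ∧ ∀ z ∈ U, z - p = ‖z - p‖ * exp (A z * I) := by
  classical
  have := hsc.simplyConnectedSpace
  have := hU.locallyPathConnectedSpace
  have hne : ∀ z ∈ U, z - p ≠ 0 := fun z hz h => hp (sub_eq_zero.1 h ▸ hz)
  obtain ⟨z₀, hz₀⟩ := hsc.nonempty
  obtain ⟨L, ⟨-, hL⟩, -⟩ := isCoveringMapOn_exp.existsUnique_continuousMap_lifts
    (⟨fun z : U => z - p, by fun_prop⟩ : C(U, ℂ)) (a₀ := ⟨z₀, hz₀⟩)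
    (exp_log (hne z₀ hz₀)) fun z => hne z z.2
  have hexp (z : U) : exp (L z) = z - p := congrFun hL z
  refine ⟨fun z => if hz : z ∈ U then (L ⟨z, hz⟩).im else 0, ?_, fun z hz => ?_⟩
  · rw [continuousOn_iff_continuous_domRestrict]
    exact (continuous_im.comp L.continuous).congr fun z => by simp
  · simp only [dif_pos hz]
    rw [← hexp ⟨z, hz⟩, norm_exp, ofReal_exp, ← exp_add, re_add_im]

namespace PlanarRegion

open PlanarDrawing

variable {V D : Type*} {R : PlanarRegion V D}

/-- The darts with the face on their left. -/
def sides (R : PlanarRegion V D) : Set D := {d | ∃ b, R.IsSide d b}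

/-- There is a vertical cut of the face going up from `p`, with the strip of `l` on its left and the
strip of `r` on its right. -/
def IsCut (R : PlanarRegion V D) (p : ℂ) (l r : D) : Prop :=
  (∃ z, R.IsFoot p z) ∧ ∀ z₀, R.IsFoot p z₀ →
    (∀ᶠ z in 𝓝 z₀, z.re < p.re → z ∈ R.strip l) ∧ ∀ᶠ z in 𝓝 z₀, p.re < z.re → z ∈ R.strip r

lemma IsCut.exists_left {p : ℂ} {l r : D} (h : R.IsCut p l r) {z₀ : ℂ} (hz₀ : R.IsFoot p z₀)
    {Q : ℂ → Prop} (hQ : ∀ᶠ z in 𝓝 z₀, Q z) : ∃ z ∈ R.strip l, z.re < p.re ∧ Q z := by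
  obtain ⟨z, hlt, hz, hQz⟩ :=
    ((frequently_re_lt z₀).and_eventually ((h.2 z₀ hz₀).1.and hQ)).exists
  rw [hz₀.re_eq] at hlt
  exact ⟨z, hz hlt, hlt, hQz⟩

lemma IsCut.exists_right {p : ℂ} {l r : D} (h : R.IsCut p l r) {z₀ : ℂ} (hz₀ : R.IsFoot p z₀)
    {Q : ℂ → Prop} (hQ : ∀ᶠ z in 𝓝 z₀, Q z) : ∃ z ∈ R.strip r, p.re < z.re ∧ Q z := by
  obtain ⟨z, hlt, hz, hQz⟩ :=
    ((frequently_re_gt z₀).and_eventually ((h.2 z₀ hz₀).2.and hQ)).exists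
  rw [hz₀.re_eq] at hlt
  exact ⟨z, hz hlt, hlt, hQz⟩

lemma IsCut.nonempty_left {p : ℂ} {l r : D} (h : R.IsCut p l r) : (R.strip l).Nonempty := by
  obtain ⟨z₀, hz₀⟩ := h.1
  obtain ⟨z, hz, -⟩ := h.exists_left hz₀ (.of_forall fun _ => trivial)
  exact ⟨z, hz⟩

lemma IsCut.nonempty_right {p : ℂ} {l r : D} (h : R.IsCut p l r) : (R.strip r).Nonempty := by
  obtain ⟨z₀, hz₀⟩ := h.1
  obtain ⟨z, hz, -⟩ := h.exists_right hz₀ (.of_forall fun _ => trivial)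
  exact ⟨z, hz⟩

section Connected

variable {X : Type*} {a : D → X}
  (ha : ∀ v, ∀ p ∈ R.lift v, ∀ z₀, R.IsFoot p z₀ → ∃ l r, R.IsCut p l r ∧ a l = a r)

include ha

lemma exists_eventually_strip_eq {z₀ : ℂ} (hz₀ : z₀ ∈ R.region) :
    ∃ x, ∀ᶠ z in 𝓝 z₀, z.re ≠ z₀.re → ∃ d, z ∈ R.strip d ∧ a d = x := by
  rcases exists_mem_strip_or_isFoot_vertex hz₀ with ⟨d, hd⟩ | ⟨v, p, hp, hfoot⟩
  · refine ⟨a d, ?_⟩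
    filter_upwards [(isOpen_strip d).mem_nhds hd] with z hz _ using ⟨d, hz, rfl⟩
  · obtain ⟨l, r, hcut, heq⟩ := ha v p hp z₀ hfoot
    refine ⟨a r, ?_⟩
    filter_upwards [(hcut.2 z₀ hfoot).1, (hcut.2 z₀ hfoot).2] with z hl hr hne
    rw [hfoot.re_eq] at hne
    rcases hne.lt_or_gt with hlt | hlt
    exacts [⟨l, hl hlt, heq⟩, ⟨r, hr hlt, rfl⟩]

lemma eq_of_nonempty_strip {d d' : D} (hd : (R.strip d).Nonempty) (hd' : (R.strip d').Nonempty) :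
    a d = a d' := by
  have : Nonempty X := ⟨a d⟩
  choose! x hx using fun (z₀ : ℂ) (hz₀ : z₀ ∈ R.region) => exists_eventually_strip_eq ha hz₀
  have hlocal (y : ℂ) (hy : y ∈ R.region) : ∀ᶠ z in 𝓝[R.region] y, x z = x y := by
    rw [eventually_nhdsWithin_iff]
    filter_upwards [eventually_eventually_nhds.2 (hx y hy)] with z hyz hz
    obtain ⟨w, ⟨hwy, hwz⟩, hy', hz'⟩ :=
      ((frequently_re_ne_and_ne y.re z).and_eventually (hyz.and (hx z hz))).exists
    obtain ⟨e, he, hey⟩ := hy' hwy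
    obtain ⟨e', he', hez⟩ := hz' hwz
    rw [← hey, ← hez, eq_of_mem_strip he he']
  have hval {e : D} {z : ℂ} (hz : z ∈ R.strip e) : a e = x z := by
    obtain ⟨w, ⟨hne, -⟩, hw, hw'⟩ := ((frequently_re_ne_and_ne z.re z).and_eventually
      (((isOpen_strip e).eventually_mem hz).and (hx z (strip_subset_region e hz)))).exists
    obtain ⟨e', he', hex⟩ := hw' hne
    rw [← hex, eq_of_mem_strip hw he']
  obtain ⟨z, hz⟩ := hd
  obtain ⟨z', hz'⟩ := hd'
  rw [hval hz, hval hz']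
  exact eq_of_eventually_eq_of_isPreconnected isPreconnected_region hlocal
    (strip_subset_region d hz) (strip_subset_region d' hz')

end Connected

lemma exists_nonempty_strip (R : PlanarRegion V D)
    (hcut : ∀ v, ∀ p ∈ R.lift v, ∀ z₀, R.IsFoot p z₀ → ∃ l r, R.IsCut p l r) :
    ∃ d, (R.strip d).Nonempty := by
  obtain ⟨z, hz⟩ := R.isSimplyConnected.nonempty
  rcases exists_mem_strip_or_isFoot_vertex hz with ⟨d, hd⟩ | ⟨v, p, hp, hfoot⟩
  · exact ⟨d, z, hd⟩
  · obtain ⟨l, r, hlr⟩ := hcut v p hp z hfoot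
    exact ⟨l, hlr.nonempty_left⟩

lemma exists_eq_int_of_eq_norm_mul_exp {w : ℂ} (hw : w ≠ 0) {θ : ℝ} (h : w = ‖w‖ * exp (θ * I)) :
    ∃ n : ℤ, (θ - Real.pi / 2 - ccwAngle I w) / (2 * Real.pi) = n := by
  obtain ⟨r, hr, hrw⟩ := exists_eq_mul_exp_ccwAngle I_ne_zero hw
  have hnorm : ‖w‖ = r := by
    rw [hrw, mul_assoc, mul_left_comm]
    simp [Complex.norm_exp_ofReal_mul_I, abs_of_pos hr]
  rw [hnorm] at h
  have hexp : exp (θ * I) = exp (Real.pi / 2 * I + ccwAngle I w * I) := by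
    rw [Complex.exp_add, Complex.exp_pi_div_two_mul_I]
    refine mul_left_cancel₀ (ofReal_ne_zero.2 hr.ne') ?_
    rw [← h]
    linear_combination hrw
  obtain ⟨n, hn⟩ := Complex.exp_eq_exp_iff_exists_int.1 hexp
  have hθ : θ = Real.pi / 2 + ccwAngle I w + n * (2 * Real.pi) := by
    rw [← ofReal_inj]
    push_cast
    exact mul_right_cancel₀ I_ne_zero (by linear_combination hn)
  exact ⟨n, by rw [div_eq_iff (by positivity), hθ]; ring⟩

-- Two branches of the argument around `p` are compared: one continuous on the face, the other with
-- the ray up from `p` as its cut. Their difference changes exactly across that ray.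
lemma exists_jump_function {v : V} {p : ℂ} (hp : p ∈ R.lift v) : ∃ F : ℂ → ℝ,
    (∀ z ∈ R.region, z ∉ upRay p → ∀ᶠ z' in 𝓝 z, F z' = F z) ∧
    ∀ z₀, R.IsFoot p z₀ → ∃ s ∈ 𝓝 z₀, ∀ z ∈ s, ∀ z' ∈ s, z.re < p.re → p.re < z'.re →
      F z ≠ F z' := by
  have hpR : p ∉ R.region := fun h => notMem_graph h (mem_graph_of_mem_lift hp)
  obtain ⟨A, hcont, hA⟩ := exists_continuousOn_angle isOpen_region R.isSimplyConnected hpR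
  have hAt {z : ℂ} (hz : z ∈ R.region) : ContinuousAt A z :=
    hcont.continuousAt (isOpen_region.mem_nhds hz)
  have hinteger (z : ℂ) (hz : z ∈ R.region) :
      ∃ n : ℤ, (A z - Real.pi / 2 - ccwAngle I (z - p)) / (2 * Real.pi) = n :=
    exists_eq_int_of_eq_norm_mul_exp (sub_ne_zero.2 fun h : z = p => hpR (h ▸ hz)) (hA z hz)
  refine ⟨fun z => (A z - Real.pi / 2 - ccwAngle I (z - p)) / (2 * Real.pi), ?_, ?_⟩
  · intro z hz hray
    have hslit : -((z - p) / I) ∈ slitPlane := neg_div_I_mem_slitPlane fun s hs heq =>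
      hray (by rw [sub_eq_iff_eq_add.1 heq]; simpa [upRay] using hs)
    have hangle : ContinuousAt (fun z => ccwAngle I (z - p)) z :=
      (ContinuousAt.comp (f := fun z => -((z - p) / I)) (Complex.continuousAt_arg hslit)
        (by fun_prop)).add continuousAt_const
    have hF := (((hAt hz).sub (continuousAt_const (y := Real.pi / 2))).sub hangle).div_const
      (2 * Real.pi)
    filter_upwards [isOpen_region.mem_nhds hz, Metric.continuousAt_iff'.1 hF 1 one_pos]
      with z' hz' hdist
    obtain ⟨n, hn⟩ := hinteger z hz
    obtain ⟨m, hm⟩ := hinteger z' hz'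
    simp only [Pi.sub_apply, hn, hm, Real.dist_eq] at hdist ⊢
    have habs : |m - n| < 1 := by exact_mod_cast hdist
    exact_mod_cast sub_eq_zero.1 (Int.abs_lt_one_iff.1 habs)
  · intro z₀ hfoot
    have hnear : ∀ᶠ z in 𝓝 z₀, dist (A z) (A z₀) < Real.pi / 2 :=
      Metric.continuousAt_iff'.1 (hAt hfoot.mem_region) _ (by positivity)
    have habove : ∀ᶠ z : ℂ in 𝓝 z₀, 0 < (z - p).im := by
      obtain ⟨s, hs, rfl, -⟩ := hfoot
      exact Tendsto.eventually_const_lt hs (Continuous.tendsto' (by fun_prop) _ _ (by simp))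
    refine ⟨_, hnear.and habove, ?_⟩
    rintro z ⟨hz, him⟩ z' ⟨hz', him'⟩ hlt hlt' heq
    have hleft := ccwAngle_I_lt_of_upper_left (w := z - p) (by simpa using hlt) him
    have hright := lt_ccwAngle_I_of_upper_right (w := z' - p) (by simpa using hlt') him'
    rw [div_left_inj' (by positivity)] at heq
    rw [Real.dist_eq, abs_lt] at hz hz'
    linarith [hz.1, hz'.2]

lemma exists_value_on_strips {X : Type*} {F : ℂ → X} {p : ℂ}
    (hF : ∀ z ∈ R.region, z ∉ upRay p → ∀ᶠ z' in 𝓝 z, F z' = F z) :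
    ∃ a : D → X, ∀ d, ∀ z ∈ R.strip d, z.re < p.re ∨ Disjoint (R.strip d) (upRay p) →
      a d = F z := by
  have hconst (d : D) {J : Set ℝ} (hJ : J.OrdConnected)
      (hdisj : Disjoint (R.strip d ∩ re ⁻¹' J) (upRay p)) {z z' : ℂ}
      (hz : z ∈ R.strip d ∩ re ⁻¹' J) (hz' : z' ∈ R.strip d ∩ re ⁻¹' J) : F z = F z' :=
    eq_of_eventually_eq_of_isPreconnected (isPreconnected_strip_inter_re_preimage d hJ)
      (fun y hy => nhdsWithin_le_nhds
        (hF y (strip_subset_region d hy.1) (disjoint_left.1 hdisj hy))) hz hz'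
  have hleft (d : D) : Disjoint (R.strip d ∩ re ⁻¹' Iio p.re) (upRay p) :=
    disjoint_left.2 fun z hz hray => (mem_Iio.1 hz.2).ne hray.1
  have hex (d : D) (z₀ : ℂ) : ∃ x, ∀ z ∈ R.strip d,
      z.re < p.re ∨ Disjoint (R.strip d) (upRay p) → x = F z := by
    by_cases hd : Disjoint (R.strip d) (upRay p)
    · by_cases hne : (R.strip d).Nonempty
      · obtain ⟨w, hw⟩ := hne
        exact ⟨F w, fun z hz _ => hconst d ordConnected_univ (hd.mono_left inter_subset_left)
          ⟨hw, trivial⟩ ⟨hz, trivial⟩⟩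
      · exact ⟨F z₀, fun z hz => (hne ⟨z, hz⟩).elim⟩
    · by_cases hne : (R.strip d ∩ re ⁻¹' Iio p.re).Nonempty
      · obtain ⟨w, hw⟩ := hne
        exact ⟨F w, fun z hz h => hconst d ordConnected_Iio (hleft d) hw ⟨hz, h.resolve_right hd⟩⟩
      · exact ⟨F z₀, fun z hz h => (hne ⟨z, hz, h.resolve_right hd⟩).elim⟩
  choose a ha using hex
  exact ⟨fun d => a d 0, fun d => ha d 0⟩

lemma IsCut.exists_jump {v : V} {p : ℂ} (hp : p ∈ R.lift v) {l r : D} (hcut : R.IsCut p l r)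
    (hdisj : Disjoint (R.strip r) (upRay p)) : ∃ a : D → ℝ, a l ≠ a r ∧
      ∀ p' l' r', p'.re < p.re → R.IsCut p' l' r' → a l' = a r' := by
  obtain ⟨F, hF, hjump⟩ := exists_jump_function hp
  obtain ⟨a, ha⟩ := exists_value_on_strips hF
  refine ⟨a, ?_, fun p' l' r' hlt hcut' => ?_⟩
  · obtain ⟨z₀, hz₀⟩ := hcut.1
    obtain ⟨s, hs, hne⟩ := hjump z₀ hz₀
    obtain ⟨z, hz, hzp, hzs⟩ := hcut.exists_left hz₀ hs
    obtain ⟨z', hz', hpz', hzs'⟩ := hcut.exists_right hz₀ hs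
    rw [ha l z hz (Or.inl hzp), ha r z' hz' (Or.inr hdisj)]
    exact hne z hzs z' hzs' hzp hpz'
  · obtain ⟨z₀, hz₀⟩ := hcut'.1
    have hre : z₀.re < p.re := hz₀.re_eq.trans_lt hlt
    have hlocal := (hF z₀ hz₀.mem_region fun hray => hre.ne hray.1).and
      (Complex.continuous_re.continuousAt.eventually_lt_const hre)
    obtain ⟨z, hz, -, hFz, hzp⟩ := hcut'.exists_left hz₀ hlocal
    obtain ⟨z', hz', -, hFz', hzp'⟩ := hcut'.exists_right hz₀ hlocal
    rw [ha l' z hz (Or.inl hzp), ha r' z' hz' (Or.inl hzp'), hFz, hFz']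

variable [Finite D]

lemma exists_isCut {d : D} {p : ℂ} (hup : R.IsUpCorner d) (hp : p ∈ R.lift (R.src (R.rev d)))
    (hcor : R.HasCorner d p) : ∃ l r, R.IsCut p l r ∧ Disjoint (R.strip r) (upRay p) := by
  obtain ⟨r, hdisj, hr⟩ := exists_strip_right_of_corner hup hp hcor
  obtain ⟨l, hl⟩ := exists_strip_left_of_corner hup hp hcor
  exact ⟨l, r, ⟨exists_isFoot_of_eventually (hcor.eventually_add_mul_I_mem hup),
    fun z₀ hz₀ => ⟨hl z₀ hz₀, hr z₀ hz₀⟩⟩, hdisj⟩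

lemma IsFoot.exists_hasCorner {v : V} {p z : ℂ} (h : R.IsFoot p z) (hp : p ∈ R.lift v) :
    ∃ d, p ∈ R.lift (R.src (R.rev d)) ∧ R.IsUpCorner d ∧ R.HasCorner d p := by
  obtain ⟨d, rfl, hup, hcor⟩ :=
    exists_hasCorner_of_frequently_add_mul_I_mem hp h.eventually_add_mul_I_mem.frequently
  exact ⟨d, hp, hup, hcor⟩

theorem ncard_floor_sides (R : PlanarRegion V D) : {d ∈ R.sides | 0 < (R.vec d).re}.ncard =
    {d ∈ R.sides | R.IsUpCorner d}.ncard + 1 := by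
  have hcorner (c : {d ∈ R.sides | R.IsUpCorner d}) :
      ∃ p, p ∈ R.lift (R.src (R.rev c)) ∧ R.HasCorner c p := by
    obtain ⟨c, ⟨b, hb⟩, hup⟩ := c
    exact ⟨_, R.add_vec_mem_lift c b hb.1, (hasCorner_add_vec_iff hb.1).2 hb⟩
  choose p hp hcor using hcorner
  choose l r hcut hdisj using fun c => exists_isCut c.2.2 (hp c) (hcor c)
  have hcuts (v : V) (q : ℂ) (hq : q ∈ R.lift v) (z₀ : ℂ) (hz₀ : R.IsFoot q z₀) :
      ∃ c, p c = q := by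
    obtain ⟨d, hqd, hup, hcorner⟩ := hz₀.exists_hasCorner hq
    have hside := HasCorner.isSide hqd hcorner
    refine ⟨⟨d, ⟨_, hside⟩, hup⟩, ?_⟩
    exact sub_left_injective ((HasCorner.isSide (hp ⟨d, ⟨_, hside⟩, hup⟩) (hcor _)).unique hside)
  have hfloor (d : D) : d ∈ {d ∈ R.sides | 0 < (R.vec d).re} ↔ (R.strip d).Nonempty :=
    nonempty_strip_iff.symm
  obtain ⟨d₀, hd₀⟩ := exists_nonempty_strip R fun v q hq z₀ hz₀ => by
    obtain ⟨c, rfl⟩ := hcuts v q hq z₀ hz₀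
    exact ⟨l c, r c, hcut c⟩
  have : Nonempty {d ∈ R.sides | 0 < (R.vec d).re} := ⟨⟨d₀, (hfloor d₀).2 hd₀⟩⟩
  refine card_eq_card_add_one_of_cuts
    (fun c => (⟨l c, (hfloor _).2 (hcut c).nonempty_left⟩ : {d ∈ R.sides | 0 < (R.vec d).re}))
    (fun c => ⟨r c, (hfloor _).2 (hcut c).nonempty_right⟩) (fun a ha d d' => ?_)
    (key := fun c => (p c).re) (fun c c' hcc => ?_) fun c => ?_
  · have hext (e) : Function.extend Subtype.val a 0 e.1 = a e :=
      Subtype.val_injective.extend_apply a 0 e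
    rw [← hext d, ← hext d']
    refine eq_of_nonempty_strip (fun v q hq z₀ hz₀ => ?_) ((hfloor _).1 d.2) ((hfloor _).1 d'.2)
    obtain ⟨c, rfl⟩ := hcuts v q hq z₀ hz₀
    exact ⟨l c, r c, hcut c, (hext ⟨l c, _⟩).trans ((ha c).trans (hext ⟨r c, _⟩).symm)⟩
  · have hpp : p c = p c' := R.re_inj _ _ _ (hp c) _ (hp c') hcc
    exact Subtype.ext (c.2.2.eq_of_src_rev_eq c'.2.2
      (R.lift_inj _ _ (p c) (hp c) (hpp ▸ hp c')))
  · obtain ⟨a, hne, heq⟩ := (hcut c).exists_jump (hp c) (hdisj c)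
    exact ⟨fun d => a d, hne, fun c' hlt => heq _ _ _ hlt (hcut c')⟩

omit [Finite D] in
lemma ccwAngle_vec_I_ne_two_pi (d : D) : ccwAngle (R.vec d) I ≠ 2 * Real.pi := by
  rw [Ne, ccwAngle_eq_two_pi_iff (R.vec_ne_zero d) I_ne_zero]
  rintro ⟨r, hr, h⟩
  have hre : r * (R.vec d).re = 0 := by simpa using congrArg Complex.re h.symm
  exact (mul_ne_zero hr.ne' (R.vec_re_ne d)) hre

lemma next_mem_sides {d : D} (h : d ∈ R.sides) : R.next d ∈ R.sides :=
  let ⟨_, hb⟩ := h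
  ⟨_, hb.next⟩

@[to_additive]
lemma prod_sides_next {M : Type*} [CommMonoid M] {S : Finset D} (hS : (S : Set D) = R.sides)
    (f : D → M) : ∏ d ∈ S, f (R.next d) = ∏ d ∈ S, f d := by
  have hmaps : ∀ d ∈ S, R.next d ∈ S := fun d hd => by
    rw [← Finset.mem_coe, hS] at hd ⊢
    exact next_mem_sides hd
  have hinj : InjOn R.next S := R.next_injective.injOn
  exact Finset.prod_nbij R.next hmaps hinj
    (Finset.surjOn_of_injOn_of_card_le R.next hmaps hinj le_rfl) fun _ _ => rfl

open Classical in
lemma exp_ccwAngle_next_rev (d : D) :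
    exp (-(I / 2) * ccwAngle (R.vec (R.next d)) (R.vec (R.rev d))) =
      halfAngle I (R.vec (R.next d)) / halfAngle I (R.vec (R.rev d)) *
        if R.IsUpCorner d then -1 else 1 := by
  rw [halfAngle_div_halfAngle_eq_exp_ccwAngle (R.vec_ne_zero _) (R.vec_ne_zero _) I_ne_zero,
    mul_assoc]
  simp only [ccwAngle_vec_I_ne_two_pi, or_false, PlanarDrawing.IsUpCorner]
  by_cases h : ccwAngle (R.vec (R.next d)) I < ccwAngle (R.vec (R.next d)) (R.vec (R.rev d)) <;>
    simp [h]

open Classical in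
theorem prod_exp_ccwAngle_sides {S : Finset D} (hS : (S : Set D) = R.sides) {m : ℕ}
    (hm : S.card = 2 * m) :
    ∏ d ∈ S, exp (-(I / 2) * ccwAngle (R.vec (R.next d)) (R.vec (R.rev d))) =
      (-1) ^ (m + 1) := by
  have hcard (q : D → Prop) : {d ∈ R.sides | q d}.ncard = (S.filter q).card := by
    rw [← hS, ← Set.ncard_coe_finset, Finset.coe_filter]
    simp only [Finset.mem_coe]
  have hfloor := R.ncard_floor_sides
  have hsplit := S.card_filter_add_card_filter_not fun d => 0 < (R.vec d).re
  rw [hcard, hcard] at hfloor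
  rw [hfloor, hm] at hsplit
  calc ∏ d ∈ S, exp (-(I / 2) * ccwAngle (R.vec (R.next d)) (R.vec (R.rev d)))
      = (∏ d ∈ S, halfAngle I (R.vec d) / halfAngle I (R.vec (R.rev d))) *
          ∏ d ∈ S, if R.IsUpCorner d then (-1 : ℂ) else 1 := by
        rw [Finset.prod_congr rfl fun d _ => exp_ccwAngle_next_rev d, Finset.prod_mul_distrib,
          Finset.prod_div_distrib, prod_sides_next hS fun d => halfAngle I (R.vec d),
          Finset.prod_div_distrib]
    _ = (∏ d ∈ S, if 0 < (R.vec d).re then I else -I) *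
          ∏ d ∈ S, if R.IsUpCorner d then (-1 : ℂ) else 1 := by
        simp only [R.vec_rev, halfAngle_I_div_neg (R.vec_re_ne _)]
    _ = (-1) ^ (m + 1) := by
        rw [Finset.prod_ite, Finset.prod_ite]
        simp only [Finset.prod_const, one_pow, mul_one]
        rw [hfloor, I_pow_mul_neg_I_pow_mul_neg_one_pow hsplit]

end PlanarRegion

/-! ### The universal covering of the torus -/

/-- The universal covering of the flat torus by the plane, in which the coordinate of the plane is
chosen such that multiplication by `κ` gives the standard one. The choice of `κ` decides which
direction on the torus is vertical. -/
def torusCover (Λ : Submodule ℤ ℂ) (κ : ℂ) : ℂ →+ FlatTorus Λ :=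
  (QuotientAddGroup.mk' Λ.toAddSubgroup).comp (AddMonoidHom.mulLeft κ)

section TorusCover

variable {Λ : Submodule ℤ ℂ} {κ : ℂ}

lemma torusCover_apply (z : ℂ) : torusCover Λ κ z = QuotientAddGroup.mk (κ * z) := rfl

lemma torusCover_div (hκ : κ ≠ 0) (z : ℂ) : torusCover Λ κ (z / κ) = QuotientAddGroup.mk z := by
  rw [torusCover_apply, mul_div_cancel₀ _ hκ]

lemma torusCover_eq_zero_iff {z : ℂ} : torusCover Λ κ z = 0 ↔ κ * z ∈ Λ := by
  rw [torusCover_apply, QuotientAddGroup.eq_zero_iff, Submodule.mem_toAddSubgroup]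

lemma torusCover_surjective (hκ : κ ≠ 0) : Function.Surjective (torusCover Λ κ) := fun x => by
  obtain ⟨w, rfl⟩ := QuotientAddGroup.mk_surjective x
  exact ⟨w / κ, torusCover_div hκ w⟩

variable [DiscreteTopology Λ]

lemma isCoveringMap_torusCover (hκ : κ ≠ 0) : IsCoveringMap (torusCover Λ κ) := by
  have hmk : IsCoveringMap (QuotientAddGroup.mk : ℂ → FlatTorus Λ) :=
    (Λ.toAddSubgroup.isAddQuotientCoveringMap_of_comm
      (DiscreteTopology.isDiscrete (s := (Λ : Set ℂ)))).isCoveringMap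
  exact hmk.comp_homeomorph (Homeomorph.mulLeft₀ κ hκ)

lemma finite_torusCover_fiber_inter_closedBall (hκ : κ ≠ 0) (x : FlatTorus Λ) (p : ℂ) (r : ℝ) :
    {b | torusCover Λ κ b = x ∧ b ∈ Metric.closedBall p r}.Finite := by
  obtain ⟨a, rfl⟩ := torusCover_surjective hκ x
  have hclosed : IsClosed (Λ : Set ℂ) := by
    have : DiscreteTopology Λ.toAddSubgroup := ‹_›
    exact AddSubgroup.isClosed_of_discrete (H := Λ.toAddSubgroup)
  have hfin : (Metric.closedBall (κ * (p - a)) (‖κ‖ * r) ∩ (Λ : Set ℂ)).Finite :=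
    Metric.finite_isBounded_inter_isClosed (DiscreteTopology.isDiscrete (s := (Λ : Set ℂ)))
      Metric.isBounded_closedBall hclosed
  refine (hfin.preimage (f := fun z => κ * (z - a)) fun z _ w _ h =>
    sub_left_injective (mul_left_cancel₀ hκ h)).subset ?_
  rintro z ⟨hza, hzp⟩
  refine ⟨?_, torusCover_eq_zero_iff.1 (by rw [map_sub, hza, sub_self])⟩
  rw [mem_closedBall_iff_norm] at hzp ⊢
  rw [← mul_sub, norm_mul, sub_sub_sub_cancel_right]
  gcongr

lemma exists_forall_exists_norm_sub_le (Λ : Submodule ℤ ℂ) [DiscreteTopology Λ]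
    [IsZLattice ℝ Λ] : ∃ C : ℝ, ∀ z : ℂ, ∃ l ∈ Λ, ‖z - l‖ ≤ C := by
  have : Module.Free ℤ Λ := ZLattice.module_free ℝ Λ
  have : Module.Finite ℤ Λ := ZLattice.module_finite ℝ Λ
  let b := (Module.Free.chooseBasis ℤ Λ).ofZLatticeBasis ℝ Λ
  have hb : Submodule.span ℤ (Set.range b) = Λ := Module.Basis.ofZLatticeBasis_span ..
  exact ⟨∑ i, ‖b i‖, fun z => ⟨ZSpan.floor b z, hb.le (ZSpan.floor b z).2,
    ZSpan.norm_fract_le b z⟩⟩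

-- By compactness, two of the points `-(n * I)` are arbitrarily close on the torus.
lemma exists_torusCover_neg_natCast_mul_I_eq [IsZLattice ℝ Λ] (hκ : κ ≠ 0) {r : ℝ} (hr : 0 < r) :
    ∃ n : ℕ, 0 < n ∧ ∃ w : ℂ, ‖w‖ < r ∧ torusCover Λ κ (-(n * I)) = torusCover Λ κ w := by
  obtain ⟨C, hC⟩ := exists_forall_exists_norm_sub_le Λ
  choose l hl hlC using fun n : ℕ => hC (κ * -(n * I))
  obtain ⟨a, -, φ, hφ, ha⟩ := tendsto_subseq_of_bounded (Metric.isBounded_closedBall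
    (x := (0 : ℂ)) (r := C)) fun n => mem_closedBall_zero_iff.2 (hlC n)
  obtain ⟨N, hN⟩ := Metric.cauchySeq_iff.1 ha.cauchySeq (‖κ‖ * r) (by positivity)
  have hclose := hN (N + 1) N.le_succ N le_rfl
  have hlt : φ N < φ (N + 1) := hφ N.lt_succ_self
  set x : ℕ → ℂ := fun n => κ * -(n * I) - l n with hx
  refine ⟨φ (N + 1) - φ N, by lia, (x (φ (N + 1)) - x (φ N)) / κ, ?_, ?_⟩
  · rwa [norm_div, div_lt_iff₀ (norm_pos_iff.2 hκ), mul_comm r, ← dist_eq_norm]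
  · rw [← sub_eq_zero, ← map_sub, torusCover_eq_zero_iff]
    convert Λ.sub_mem (hl (φ (N + 1))) (hl (φ N)) using 1
    rw [Nat.cast_sub hlt.le, hx]
    field_simp
    ring

end TorusCover

lemma eventually_mem_segment_imp_of_finite {S : Set ℂ} {p : ℂ}
    (hS : ∀ r, {b | b ∈ S ∧ b ∈ Metric.closedBall p r}.Finite) (v : ℂ) :
    ∀ᶠ z in 𝓝 p, ∀ b ∈ S, ∀ t ∈ Icc (0 : ℝ) 1, z = b + t * v →
      ∃ t₀ ∈ Icc (0 : ℝ) 1, p = b + t₀ * v := by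
  let seg (b : ℂ) : Set ℂ := (fun t : ℝ => b + t * v) '' Icc 0 1
  have hseg (b : ℂ) : IsClosed (seg b) := (isCompact_Icc.image (by fun_prop)).isClosed
  have hnear : ∀ᶠ z in 𝓝 p, ∀ b ∈ {b | b ∈ S ∧ b ∈ Metric.closedBall p (1 + ‖v‖)},
      z ∈ seg b → p ∈ seg b := by
    rw [(hS _).eventually_all]
    intro b _
    by_cases hp : p ∈ seg b
    · exact Eventually.of_forall fun _ _ => hp
    · filter_upwards [(hseg b).isOpen_compl.mem_nhds hp] with z hz hz'
      exact absurd hz' hz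
  filter_upwards [hnear, Metric.ball_mem_nhds p one_pos] with z hz hzp b hb t ht hzt
  have hbp : b ∈ Metric.closedBall p (1 + ‖v‖) := by
    rw [mem_closedBall_iff_norm]
    rw [mem_ball_iff_norm] at hzp
    calc ‖b - p‖ = ‖(z - p) - t * v‖ := by rw [hzt]; ring_nf
      _ ≤ ‖z - p‖ + ‖(t : ℂ) * v‖ := norm_sub_le _ _
      _ ≤ 1 + ‖v‖ := by
        rw [norm_mul, norm_real, Real.norm_of_nonneg ht.1]
        exact add_le_add hzp.le (mul_le_of_le_one_left (norm_nonneg v) ht.2)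
  obtain ⟨t₀, ht₀, h⟩ := hz b ⟨hb, hbp⟩ ⟨t, ht, hzt.symm⟩
  exact ⟨t₀, ht₀, h.symm⟩

lemma exists_re_div_ne_zero {C : Set ℂ} (hC : C.Countable) :
    ∃ κ : ℂ, κ ≠ 0 ∧ ∀ z ∈ C, (z / κ).re = 0 → z = 0 := by
  obtain ⟨t, ht⟩ : ∃ t : ℝ, t ∉ (fun z : ℂ => z.re / z.im) '' C := by
    by_contra! hcon
    exact Cardinal.not_countable_real ((hC.image _).mono fun t _ => hcon t)
  have hκ : (1 + t * I : ℂ) ≠ 0 := fun h => by simpa using congrArg Complex.re h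
  refine ⟨(1 + t * I)⁻¹, inv_ne_zero hκ, fun z hz hre => ?_⟩
  have hzt : z.re = t * z.im := by
    rw [div_inv_eq_mul] at hre
    simp only [mul_re, add_re, one_re, ofReal_re, I_re, mul_zero, ofReal_im, I_im, add_im, one_im,
      mul_im] at hre
    linarith
  have him : z.im = 0 := by
    by_contra him
    exact ht ⟨z, hz, by simp only [hzt]; field_simp⟩
  exact Complex.ext (by simp [hzt, him]) him

/-! ### The lift of a toric graph to the plane -/

namespace StraightGraph

variable {Λ : Submodule ℤ ℂ} {W B E : Type*} {G : StraightGraph Λ W B E}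

/-- The opposite dart. -/
def dartRev (d : E × Bool) : E × Bool := (d.1, !d.2)

lemma dartRev_dartRev (d : E × Bool) : dartRev (dartRev d) = d := by
  simp [dartRev]

lemma dartSrc_dartRev (d : E × Bool) : G.dartSrc (dartRev d) = G.dartDst d := by
  rcases d with ⟨e, _ | _⟩ <;> rfl

lemma dartVec_dartRev (d : E × Bool) : G.dartVec (dartRev d) = -G.dartVec d := by
  rcases d with ⟨e, _ | _⟩ <;> simp [dartVec, dartRev]

/-- The parameter of a point of a dart, measured from the white end of the edge. -/
def whiteParam (c : Bool) (t : ℝ) : ℝ := if c then t else 1 - t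

lemma whiteParam_mem_Icc (c : Bool) {t : ℝ} (ht : t ∈ Icc (0 : ℝ) 1) :
    whiteParam c t ∈ Icc (0 : ℝ) 1 := by
  cases c
  · exact ⟨sub_nonneg.2 ht.2, sub_le_self 1 ht.1⟩
  · exact ht

lemma whiteParam_mem_Ioo (c : Bool) {t : ℝ} (ht : t ∈ Ioo (0 : ℝ) 1) :
    whiteParam c t ∈ Ioo (0 : ℝ) 1 := by
  cases c
  · exact ⟨sub_pos.2 ht.2, sub_lt_self 1 ht.1⟩
  · exact ht

lemma pos_dartSrc_add_mk (d : E × Bool) (t : ℝ) :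
    G.pos (G.dartSrc d) + (QuotientAddGroup.mk (t * G.dartVec d) : FlatTorus Λ) =
      G.edgePoint d.1 (whiteParam d.2 t) := by
  rcases d with ⟨e, _ | _⟩
  · simp only [dartSrc, dartVec, edgePoint, whiteParam, G.pos_black, Bool.false_eq_true, if_false]
    rw [add_assoc, ← QuotientAddGroup.mk_add]
    congr 2
    push_cast
    ring
  · rfl

lemma pos_dartDst (d : E × Bool) : G.pos (G.dartDst d) =
    G.pos (G.dartSrc d) + (QuotientAddGroup.mk (G.dartVec d) : FlatTorus Λ) := by
  rcases d with ⟨e, _ | _⟩ <;> simp [dartSrc, dartDst, dartVec, G.pos_black]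

lemma exists_dartSrc_eq (o : G.PerfectOrientation) (v : W ⊕ B) : ∃ d, G.dartSrc d = v := by
  rcases v with w | b
  · obtain ⟨e, ⟨rfl, -⟩, -⟩ := o.existsUnique_in w
    exact ⟨(e, true), rfl⟩
  · obtain ⟨e, ⟨rfl, -⟩, -⟩ := o.existsUnique_out b
    exact ⟨(e, false), rfl⟩

variable {κ : ℂ}

lemma torusCover_add_mul_dartVec (hκ : κ ≠ 0) {d : E × Bool} {b : ℂ}
    (hb : torusCover Λ κ b = G.pos (G.dartSrc d)) (c : ℂ) :
    torusCover Λ κ (b + c * (G.dartVec d / κ)) =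
      G.pos (G.dartSrc d) + (QuotientAddGroup.mk (c * G.dartVec d) : FlatTorus Λ) := by
  rw [map_add, hb, ← mul_div_assoc, torusCover_div hκ]

lemma torusCover_add_mul_dartVec_eq_edgePoint (hκ : κ ≠ 0) {d : E × Bool} {b : ℂ}
    (hb : torusCover Λ κ b = G.pos (G.dartSrc d)) (t : ℝ) :
    torusCover Λ κ (b + t * (G.dartVec d / κ)) = G.edgePoint d.1 (whiteParam d.2 t) := by
  rw [torusCover_add_mul_dartVec hκ hb, pos_dartSrc_add_mk]

lemma torusCover_add_dartVec (hκ : κ ≠ 0) {d : E × Bool} {b : ℂ}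
    (hb : torusCover Λ κ b = G.pos (G.dartSrc d)) :
    torusCover Λ κ (b + G.dartVec d / κ) = G.pos (G.dartSrc (dartRev d)) := by
  rw [dartSrc_dartRev, pos_dartDst, map_add, hb, torusCover_div hκ]

lemma eq_or_eq_dartRev_of_lifts_meet (hG : G.IsToric) (hκ : κ ≠ 0) {d d' : E × Bool} {b b' : ℂ}
    (hb : torusCover Λ κ b = G.pos (G.dartSrc d))
    (hb' : torusCover Λ κ b' = G.pos (G.dartSrc d')) {t t' : ℝ} (ht : t ∈ Ioo (0 : ℝ) 1)
    (ht' : t' ∈ Ioo (0 : ℝ) 1)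
    (h : b + t * (G.dartVec d / κ) = b' + t' * (G.dartVec d' / κ)) :
    (d' = d ∧ b' = b) ∨ (d' = dartRev d ∧ b' = b + G.dartVec d / κ) := by
  have hedge := congrArg (torusCover Λ κ) h
  rw [torusCover_add_mul_dartVec_eq_edgePoint hκ hb,
    torusCover_add_mul_dartVec_eq_edgePoint hκ hb'] at hedge
  obtain ⟨he, hparam⟩ := hG.edgePoint_injective _ _ _ (whiteParam_mem_Ioo d.2 ht) _
    (whiteParam_mem_Ioo d'.2 ht') hedge
  by_cases hd : d'.2 = d.2
  · obtain rfl : d' = d := Prod.ext he.symm hd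
    have htt : t = t' := by
      unfold whiteParam at hparam
      split_ifs at hparam <;> linarith
    subst htt
    exact Or.inl ⟨rfl, (add_right_cancel h).symm⟩
  · obtain rfl : d' = dartRev d := Prod.ext he.symm (Bool.eq_not.2 hd)
    have htt : t' = 1 - t := by
      rcases d with ⟨e, _ | _⟩ <;> simp [dartRev, whiteParam] at hparam <;> linarith
    refine Or.inr ⟨rfl, ?_⟩
    rw [dartVec_dartRev, htt] at h
    push_cast at h
    linear_combination -h

section LiftedDrawing

variable [Finite E] [DiscreteTopology Λ]

/-- The lift of a toric graph to the plane, in the coordinate given by `torusCover`. -/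
def liftedDrawing (hG : G.IsToric) (o : G.PerfectOrientation) (hκ : κ ≠ 0) :
    PlanarDrawing (W ⊕ B) (E × Bool) where
  src := G.dartSrc
  rev := dartRev
  vec d := G.dartVec d / κ
  lift v := {z | torusCover Λ κ z = G.pos v}
  rev_rev := dartRev_dartRev
  vec_rev d := by rw [dartVec_dartRev, neg_div]
  exists_dart := exists_dartSrc_eq o
  add_vec_mem_lift _ _ hp := torusCover_add_dartVec hκ hp
  lift_inj _ _ _ hv hw := hG.pos_injective (hv.symm.trans hw)
  lift_nonempty _ := torusCover_surjective hκ _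
  exists_ball p := by
    obtain ⟨ε, hε, h⟩ := Metric.eventually_nhds_iff_ball.1 <| eventually_all.2 fun d =>
      eventually_mem_segment_imp_of_finite
        (finite_torusCover_fiber_inter_closedBall hκ (G.pos (G.dartSrc d)) p) (G.dartVec d / κ)
    exact ⟨ε, hε, fun d b hb t ht hz => h _ hz d b hb t ht rfl⟩
  edge_ne_vertex d _ hb _ ht v h := hG.edgePoint_ne_pos d.1 _ (whiteParam_mem_Ioo d.2 ht) v
    ((torusCover_add_mul_dartVec_eq_edgePoint hκ hb _).symm.trans h)
  edge_inj _ _ _ hb _ hb' _ ht _ ht' h := eq_or_eq_dartRev_of_lifts_meet hG hκ hb hb' ht ht' h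

lemma mem_graph_liftedDrawing_iff (hG : G.IsToric) (o : G.PerfectOrientation) (hκ : κ ≠ 0)
    {z : ℂ} : z ∈ (liftedDrawing hG o hκ).graph ↔ torusCover Λ κ z ∈ G.support := by
  constructor
  · rintro ⟨d, b, hb, t, ht, rfl⟩
    exact Or.inr (mem_iUnion.2 ⟨d.1, _, whiteParam_mem_Icc d.2 ht,
      (torusCover_add_mul_dartVec_eq_edgePoint hκ hb t).symm⟩)
  · rintro (⟨v, hv⟩ | h)
    · exact PlanarDrawing.mem_graph_of_mem_lift (P := liftedDrawing hG o hκ) hv.symm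
    · obtain ⟨e, t, ht, he⟩ := mem_iUnion.1 h
      refine ⟨(e, true), z - t * (G.vec e / κ), ?_, t, ht, (sub_add_cancel _ _).symm⟩
      change torusCover Λ κ _ = G.pos (Sum.inl (G.white e))
      rw [map_sub, ← he, ← mul_div_assoc, torusCover_div hκ, edgePoint, add_sub_cancel_right]

lemma isClosed_support (hG : G.IsToric) (o : G.PerfectOrientation) : IsClosed G.support := by
  have hq : IsQuotientMap (torusCover Λ 1) :=
    (isCoveringMap_torusCover one_ne_zero).isQuotientMap (torusCover_surjective one_ne_zero)
  rw [← isOpen_compl_iff, ← hq.isOpen_preimage, Metric.isOpen_iff]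
  intro p hp
  obtain ⟨ε, hε, h⟩ := (liftedDrawing hG o one_ne_zero).exists_ball_disjoint_graph
    (mt (mem_graph_liftedDrawing_iff hG o one_ne_zero).1 hp)
  exact ⟨ε, hε, fun z hz => mt (mem_graph_liftedDrawing_iff hG o one_ne_zero).2
    (disjoint_left.1 h hz)⟩

end LiftedDrawing

end StraightGraph

/-! ### The lift of a face to the plane -/

namespace StraightGraph

variable {Λ : Submodule ℤ ℂ} {W B E : Type*} {G : StraightGraph Λ W B E} {κ : ℂ}
  {f : Set (FlatTorus Λ)}

lemma IsFace.disjoint_support (hf : G.IsFace f) : Disjoint f G.support := by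
  obtain ⟨x, -, rfl⟩ := hf
  exact disjoint_left.2 fun _ hx => connectedComponentIn_subset _ _ hx

lemma IsFace.subset (hf : G.IsFace f) {C : Set (FlatTorus Λ)} (hC : IsPreconnected C)
    (hd : Disjoint C G.support) (hne : (C ∩ f).Nonempty) : C ⊆ f := by
  obtain ⟨x₀, -, rfl⟩ := hf
  obtain ⟨x, hxC, hx⟩ := hne
  rw [connectedComponentIn_eq hx]
  exact hC.subset_connectedComponentIn hxC hd.subset_compl_right

lemma IsFace.isOpen [Finite E] [DiscreteTopology Λ] (hG : G.IsToric) (o : G.PerfectOrientation)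
    (hf : G.IsFace f) : IsOpen f := by
  obtain ⟨x, -, rfl⟩ := hf
  have : LocallyPathConnectedSpace (FlatTorus Λ) := Quot.locallyPathConnectedSpace
  exact (isClosed_support hG o).isOpen_compl.connectedComponentIn

lemma IsFace.exists_section [Finite E] [DiscreteTopology Λ] (hG : G.IsToric)
    (o : G.PerfectOrientation) (hf : G.IsFace f) (hκ : κ ≠ 0) :
    ∃ F : C(f, ℂ), ∀ x, torusCover Λ κ (F x) = x := by
  have := hG.contractible_of_isFace f hf
  have : LocallyPathConnectedSpace (FlatTorus Λ) := Quot.locallyPathConnectedSpace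
  have := (hf.isOpen hG o).locallyPathConnectedSpace
  obtain ⟨x⟩ : Nonempty f := inferInstance
  obtain ⟨z, hz⟩ := torusCover_surjective hκ (x : FlatTorus Λ)
  obtain ⟨F, ⟨-, hF⟩, -⟩ := (isCoveringMap_torusCover hκ).existsUnique_continuousMap_lifts
    (⟨Subtype.val, continuous_subtype_val⟩ : C(f, FlatTorus Λ)) x z hz
  exact ⟨F, congrFun hF⟩

section Section

variable {F : C(f, ℂ)} (hF : ∀ x, torusCover Λ κ (F x) = x)

include hF

lemma torusCover_mem_of_mem_range_section {z : ℂ} (hz : z ∈ range F) : torusCover Λ κ z ∈ f := by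
  obtain ⟨x, rfl⟩ := hz
  exact (hF x).symm ▸ x.2

lemma injOn_torusCover_range_section : InjOn (torusCover Λ κ) (range F) := by
  rintro _ ⟨x, rfl⟩ _ ⟨y, rfl⟩ h
  rw [hF, hF] at h
  rw [Subtype.ext h]

variable [DiscreteTopology Λ]

lemma isSimplyConnected_range_section (hκ : κ ≠ 0) [ContractibleSpace f] :
    IsSimplyConnected (range F) := by
  have hcomp : IsEmbedding (torusCover Λ κ ∘ F) := by
    rw [show torusCover Λ κ ∘ F = Subtype.val from funext hF]
    exact .subtypeVal
  have hemb := hcomp.of_comp F.continuous (isCoveringMap_torusCover hκ).continuous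
  have := hemb.toHomeomorph.symm.contractibleSpace
  exact SimplyConnectedSpace.ofContractible _

lemma IsFace.subset_range_section (hf : G.IsFace f) (hκ : κ ≠ 0) {C : Set ℂ}
    (hC : IsPreconnected C) (hd : Disjoint C (torusCover Λ κ ⁻¹' G.support))
    (hne : (C ∩ range F).Nonempty) : C ⊆ range F := by
  have hcov := isCoveringMap_torusCover (Λ := Λ) hκ
  obtain ⟨_, hz₀, x, rfl⟩ := hne
  have hmem : ∀ z ∈ C, torusCover Λ κ z ∈ f := fun z hz =>
    hf.subset (hC.image _ hcov.continuous.continuousOn)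
      (disjoint_image_left.2 hd) ⟨x, ⟨F x, hz₀, hF x⟩, x.2⟩ ⟨z, hz, rfl⟩
  have : PreconnectedSpace C := Subtype.preconnectedSpace hC
  have hlift : Continuous fun z : C => F ⟨torusCover Λ κ z, hmem z z.2⟩ :=
    F.continuous.comp ((hcov.continuous.comp continuous_subtype_val).subtype_mk _)
  have hunique := hcov.eq_of_comp_eq hlift continuous_subtype_val
    (funext fun z => by simp [hF]) ⟨F x, hz₀⟩ (congrArg F (Subtype.ext (hF x)))
  exact fun z hz => ⟨_, congrFun hunique ⟨z, hz⟩⟩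

lemma IsFace.isOpen_range_section [Finite E] (hf : G.IsFace f) (hG : G.IsToric)
    (o : G.PerfectOrientation) (hκ : κ ≠ 0) : IsOpen (range F) := by
  refine Metric.isOpen_iff.2 fun p hp => ?_
  have hgraph : p ∉ (liftedDrawing hG o hκ).graph := fun h =>
    disjoint_left.1 hf.disjoint_support (torusCover_mem_of_mem_range_section hF hp)
      ((mem_graph_liftedDrawing_iff hG o hκ).1 h)
  obtain ⟨ε, hε, hball⟩ := PlanarDrawing.exists_ball_disjoint_graph hgraph
  exact ⟨ε, hε, hf.subset_range_section hF hκ (convex_ball p ε).isPreconnected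
    (hball.mono_right fun z hz => (mem_graph_liftedDrawing_iff hG o hκ).2 hz)
    ⟨p, Metric.mem_ball_self hε, hp⟩⟩

-- The vertical line below `z` returns close to `z` on the torus, where `F` has other values.
lemma exists_sub_mul_I_notMem_range_section [IsZLattice ℝ Λ] (hκ : κ ≠ 0)
    (hopen : IsOpen (range F)) {z : ℂ} (hz : z ∈ range F) :
    ∃ s : ℝ, 0 < s ∧ z - s * I ∉ range F := by
  by_contra! hcon
  obtain ⟨ε, hε, hball⟩ := Metric.isOpen_iff.1 hopen z hz
  obtain ⟨n, hn, w, hw, hnw⟩ := exists_torusCover_neg_natCast_mul_I_eq (Λ := Λ) hκ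
    (lt_min hε one_pos)
  have hn1 : (1 : ℝ) ≤ n := by exact_mod_cast hn
  have hzw : z + w ∈ range F :=
    hball (by simpa [mem_ball_iff_norm] using hw.trans_le (min_le_left _ _))
  have heq : z - (n : ℝ) * I = z + w :=
    injOn_torusCover_range_section hF (hcon n (by linarith)) hzw
      (by rw [sub_eq_add_neg, map_add, map_add, ofReal_natCast, hnw])
  have hwn : w = -((n : ℝ) * I) := by linear_combination -heq
  have hnorm : ‖w‖ = n := by simp [hwn]
  linarith [hw.trans_le (min_le_right ε 1)]

end Section

/-- A coordinate in which no two lifted vertices are on the same vertical line; in particular, no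
edge is vertical. -/
def IsGenericDirection (G : StraightGraph Λ W B E) (κ : ℂ) : Prop :=
  κ ≠ 0 ∧ ∀ p q, torusCover Λ κ p ∈ range G.pos → torusCover Λ κ q ∈ range G.pos →
    p.re = q.re → p = q

lemma exists_isGenericDirection [DiscreteTopology Λ] [IsZLattice ℝ Λ] [Countable (W ⊕ B)] :
    ∃ κ, G.IsGenericDirection κ := by
  choose a ha using fun v => QuotientAddGroup.mk_surjective (G.pos v)
  let X : Set ℂ := range fun x : (W ⊕ B) × Λ => a x.1 + x.2
  have hX {z : ℂ} (hz : (QuotientAddGroup.mk z : FlatTorus Λ) ∈ range G.pos) : z ∈ X := by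
    obtain ⟨v, hv⟩ := hz
    rw [← ha, QuotientAddGroup.eq, Submodule.mem_toAddSubgroup] at hv
    exact ⟨(v, ⟨_, hv⟩), add_neg_cancel_left _ _⟩
  obtain ⟨κ, hκ, h⟩ := exists_re_div_ne_zero (C := image2 (· - ·) X X)
    ((countable_range _).image2 (countable_range _) _)
  refine ⟨κ, hκ, fun p q hp hq hre => ?_⟩
  have hzero := h (κ * p - κ * q) ⟨κ * p, hX hp, κ * q, hX hq, rfl⟩ (by
    rw [← mul_sub, mul_div_cancel_left₀ _ hκ, sub_re, hre, sub_self])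
  exact mul_left_cancel₀ hκ (sub_eq_zero.1 hzero)

lemma IsGenericDirection.dartVec_div_re_ne_zero [Finite E] [DiscreteTopology Λ] (hG : G.IsToric)
    (o : G.PerfectOrientation) (hκ : G.IsGenericDirection κ) (d : E × Bool) :
    (G.dartVec d / κ).re ≠ 0 := by
  intro h
  obtain ⟨p, hp⟩ := torusCover_surjective hκ.1 (G.pos (G.dartSrc d))
  have heq := hκ.2 _ _ ⟨_, hp.symm⟩ ⟨_, (torusCover_add_dartVec hκ.1 hp).symm⟩ (by simp [h])
  exact (liftedDrawing hG o hκ.1).vec_ne_zero d (left_eq_add.1 heq)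

section LiftedFace

variable [Finite E] [DiscreteTopology Λ] [IsZLattice ℝ Λ] (hG : G.IsToric)
  (o : G.PerfectOrientation) (hκ : G.IsGenericDirection κ) (hf : G.IsFace f) {F : C(f, ℂ)}
  (hF : ∀ x, torusCover Λ κ (F x) = x)

/-- The lift of a face to the plane, by a section `F` of the covering. -/
def liftedFace : PlanarRegion (W ⊕ B) (E × Bool) where
  toPlanarDrawing := liftedDrawing hG o hκ.1
  region := range F
  vec_re_ne := hκ.dartVec_div_re_ne_zero hG o
  re_inj _ _ _ hp _ hq h := hκ.2 _ _ ⟨_, hp.symm⟩ ⟨_, hq.symm⟩ h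
  isSimplyConnected :=
    have := hG.contractible_of_isFace f hf
    isSimplyConnected_range_section hF hκ.1
  disjoint_graph := disjoint_left.2 fun _ hz hgraph =>
    disjoint_left.1 hf.disjoint_support (torusCover_mem_of_mem_range_section hF hz)
      ((mem_graph_liftedDrawing_iff hG o hκ.1).1 hgraph)
  maximal _ hC hd hne := hf.subset_range_section hF hκ.1 hC
    (hd.mono_right fun _ hz => (mem_graph_liftedDrawing_iff hG o hκ.1).2 hz) hne
  exists_notMem_below _ hz :=
    exists_sub_mul_I_notMem_range_section hF hκ.1 (hf.isOpen_range_section hF hG o hκ.1) hz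
  lift_unique v b hb b' hb' z hz hz' := by
    have hbb' : torusCover Λ κ b' = torusCover Λ κ b :=
      (hb' : _ = G.pos v).trans (hb : _ = G.pos v).symm
    have heq := injOn_torusCover_range_section hF hz hz' (by
      rw [map_add, map_sub, hbb', sub_self, add_zero])
    linear_combination heq

end LiftedFace

end StraightGraph

namespace StraightGraph

variable {Λ : Submodule ℤ ℂ} {W B E : Type*} {G : StraightGraph Λ W B E} {κ : ℂ}
  {f : Set (FlatTorus Λ)} [Finite E] [DiscreteTopology Λ] [IsZLattice ℝ Λ] (hG : G.IsToric)
  (o : G.PerfectOrientation) (hκ : G.IsGenericDirection κ) (hf : G.IsFace f) {F : C(f, ℂ)}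
  (hF : ∀ x, torusCover Λ κ (F x) = x)

lemma LiesLeftOf.mem_sides_liftedFace {d : E × Bool} (h : G.LiesLeftOf f d) :
    d ∈ (liftedFace hG o hκ hf hF).sides := by
  have hhalf : (1 / 2 : ℝ) ∈ Ioo (0 : ℝ) 1 := by norm_num
  obtain ⟨ε, hε, hleft⟩ := mem_nhdsGT_iff_exists_Ioc_subset.1 (h _ hhalf)
  have hεmem : ε ∈ Ioc 0 ε := ⟨hε, le_rfl⟩
  let b : ℂ := F ⟨_, hleft hεmem⟩ - ((1 / 2 : ℝ) + ε * I) * (G.dartVec d / κ)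
  have hb : torusCover Λ κ b = G.pos (G.dartSrc d) := by
    rw [map_sub, hF, ← mul_div_assoc, torusCover_div hκ.1, add_sub_cancel_right]
  have hface : ∀ s ∈ Ioc 0 ε,
      torusCover Λ κ (b + ((1 / 2 : ℝ) + s * I) * (G.dartVec d / κ)) ∈ f := fun s hs => by
    rw [torusCover_add_mul_dartVec hκ.1 hb]
    exact hleft hs
  have hregion : (fun s : ℝ => b + ((1 / 2 : ℝ) + s * I) * (G.dartVec d / κ)) '' Ioc 0 ε ⊆
      range F :=
    hf.subset_range_section hF hκ.1 (isPreconnected_Ioc.image _ (by fun_prop))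
      (disjoint_left.2 <| forall_mem_image.2 fun s hs =>
        disjoint_left.1 hf.disjoint_support (hface s hs))
      ⟨_, mem_image_of_mem _ hεmem, _, (sub_add_cancel _ _).symm⟩
  exact ⟨b, PlanarRegion.isSide_of_frequently (R := liftedFace hG o hκ hf hF) hb hhalf <|
    (tendsto_add_mul_leftHalfPlane (PlanarDrawing.vec_ne_zero _ d) b _).frequently <|
      Eventually.frequently <|
        eventually_of_mem (Ioc_mem_nhdsGT hε) fun s hs => hregion (mem_image_of_mem _ hs)⟩

lemma liesLeftOf_iff_mem_sides_liftedFace {d : E × Bool} :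
    G.LiesLeftOf f d ↔ d ∈ (liftedFace hG o hκ hf hF).sides := by
  refine ⟨fun h => h.mem_sides_liftedFace hG o hκ hf hF, ?_⟩
  rintro ⟨b, hb, hside⟩ t ht
  have htend := tendsto_add_mul_leftHalfPlane
    (PlanarDrawing.vec_ne_zero (liftedFace hG o hκ hf hF).toPlanarDrawing d) b t
  filter_upwards [htend.eventually (hside t ht)] with s hs
  rw [← torusCover_add_mul_dartVec hκ.1 hb]
  exact torusCover_mem_of_mem_range_section hF hs

end StraightGraph

/-! ### The marking of a perfect orientation -/

namespace StraightGraph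

variable {Λ : Submodule ℤ ℂ} {W B E : Type*} {G : StraightGraph Λ W B E}

lemma snd_eq_of_dartSrc_eq {d d' : E × Bool} (h : G.dartSrc d = G.dartSrc d') : d.2 = d'.2 := by
  rcases d with ⟨e, _ | _⟩ <;> rcases d' with ⟨e', _ | _⟩ <;> simp_all [dartSrc]

lemma dartVec_ne_zero [Finite E] [DiscreteTopology Λ] (hG : G.IsToric) (o : G.PerfectOrientation)
    (d : E × Bool) : G.dartVec d ≠ 0 :=
  fun h => (liftedDrawing hG o one_ne_zero).vec_ne_zero d (by simp [liftedDrawing, h])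

namespace PerfectOrientation

variable (o : G.PerfectOrientation)

lemma white_pred (e : E) : G.white (o.pred e) = G.white e :=
  (Classical.choose_spec (o.existsUnique_in (G.white e)).exists).1

lemma toBlack_pred (e : E) : o.toBlack (o.pred e) = false :=
  (Classical.choose_spec (o.existsUnique_in (G.white e)).exists).2

lemma black_succ (e : E) : G.black (o.succ e) = G.black e :=
  (Classical.choose_spec (o.existsUnique_out (G.black e)).exists).1

lemma toBlack_succ (e : E) : o.toBlack (o.succ e) = false :=
  (Classical.choose_spec (o.existsUnique_out (G.black e)).exists).2

/-- The dart along the unique black-to-white edge at the initial vertex of `d`, leaving that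
vertex. -/
def axisDart (d : E × Bool) : E × Bool := (if d.2 then o.pred d.1 else o.succ d.1, d.2)

lemma dartSrc_axisDart (d : E × Bool) : G.dartSrc (o.axisDart d) = G.dartSrc d := by
  rcases d with ⟨e, _ | _⟩
  · simp [axisDart, dartSrc, o.black_succ]
  · simp [axisDart, dartSrc, o.white_pred]

lemma toBlack_axisDart (d : E × Bool) : o.toBlack (o.axisDart d).1 = false := by
  rcases d with ⟨e, _ | _⟩
  · exact o.toBlack_succ e
  · exact o.toBlack_pred e

variable {o} in
lemma eq_of_toBlack_eq_false {d d' : E × Bool} (h : G.dartSrc d = G.dartSrc d')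
    (hd : o.toBlack d.1 = false) (hd' : o.toBlack d'.1 = false) : d = d' := by
  obtain ⟨e, c⟩ := d
  obtain ⟨e', c'⟩ := d'
  obtain rfl : c = c' := snd_eq_of_dartSrc_eq h
  cases c
  · have he := (o.existsUnique_out (G.black e')).unique ⟨Sum.inr_injective h, hd⟩ ⟨rfl, hd'⟩
    exact congrArg (·, false) he
  · have he := (o.existsUnique_in (G.white e')).unique ⟨Sum.inl_injective h, hd⟩ ⟨rfl, hd'⟩
    exact congrArg (·, true) he

lemma axisDart_eq_iff {d : E × Bool} : o.axisDart d = d ↔ o.toBlack d.1 = false :=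
  ⟨fun h => h ▸ o.toBlack_axisDart d,
    eq_of_toBlack_eq_false (o.dartSrc_axisDart d) (o.toBlack_axisDart d)⟩

lemma axisDart_congr {d d' : E × Bool} (h : G.dartSrc d = G.dartSrc d') :
    o.axisDart d = o.axisDart d' :=
  eq_of_toBlack_eq_false ((o.dartSrc_axisDart d).trans (h.trans (o.dartSrc_axisDart d').symm))
    (o.toBlack_axisDart d) (o.toBlack_axisDart d')

/-- The displacement vector of `axisDart d`, the cut from which angles at the initial vertex of
`d` are measured. -/
def axis (d : E × Bool) : ℂ := G.dartVec (o.axisDart d)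

lemma axis_congr {d d' : E × Bool} (h : G.dartSrc d = G.dartSrc d') : o.axis d = o.axis d' := by
  rw [axis, axis, o.axisDart_congr h]

/-- The half angle of the displacement vector of `d`, measured from the axis. -/
def halfTurn (d : E × Bool) : ℂ := halfAngle (o.axis d) (G.dartVec d)

/-- The sign of a dart: `-1` along the black-to-white edges and `1` along the others. -/
def dartSign (d : E × Bool) : ℂ := if o.toBlack d.1 then 1 else -1

lemma dartSign_sq (d : E × Bool) : o.dartSign d ^ 2 = 1 := by
  unfold dartSign
  split_ifs <;> norm_num

lemma marking_ne_zero (e : E) : o.marking e ≠ 0 := by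
  unfold marking turn
  split_ifs
  · exact Complex.exp_ne_zero _
  · norm_num

section Toric

variable [Finite E] [DiscreteTopology Λ] (hG : G.IsToric)

include hG

lemma axis_ne_zero (d : E × Bool) : o.axis d ≠ 0 := dartVec_ne_zero hG o _

lemma ccwAngle_axis_eq_two_pi_iff {d : E × Bool} :
    ccwAngle (G.dartVec d) (o.axis d) = 2 * Real.pi ↔ o.toBlack d.1 = false := by
  rw [← o.axisDart_eq_iff,
    ccwAngle_eq_two_pi_iff (dartVec_ne_zero hG o _) (o.axis_ne_zero hG _)]
  constructor
  · rintro ⟨r, hr, h⟩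
    exact ((liftedDrawing hG o one_ne_zero).eq_of_vec_eq (o.dartSrc_axisDart d).symm hr
      (by simp only [liftedDrawing, div_one]; exact h)).symm
  · intro h
    exact ⟨1, one_pos, by rw [axis, h, ofReal_one, one_mul]⟩

lemma halfTurn_of_toBlack_eq_false {d : E × Bool} (h : o.toBlack d.1 = false) :
    o.halfTurn d = I := by
  rw [halfTurn, axis, o.axisDart_eq_iff.2 h, halfAngle, ccwAngle_self (dartVec_ne_zero hG o d),
    show I / 2 * ((2 * Real.pi - Real.pi : ℝ) : ℂ) = Real.pi / 2 * I by push_cast; ring,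
    exp_pi_div_two_mul_I]

omit hG [Finite E] [DiscreteTopology Λ] in
lemma angleMinus_eq {e : E} (h : o.toBlack e = true) :
    o.angleMinus e = ccwAngle (o.axis (e, true)) (G.dartVec (e, true)) - Real.pi := by
  simp only [angleMinus, edgeVec, h, o.toBlack_pred, ccwAngle, axis, axisDart, dartVec,
    Bool.false_eq_true, if_true, if_false]
  rw [div_neg, add_sub_cancel_right]

lemma anglePlus_eq {e : E} (h : o.toBlack e = true) :
    o.anglePlus e = -(ccwAngle (o.axis (e, false)) (G.dartVec (e, false)) - Real.pi) := by
  have hne : ccwAngle (o.axis (e, false)) (G.dartVec (e, false)) ≠ 2 * Real.pi := fun heq => by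
    have hsymm := ccwAngle_comm_eq_two_pi (o.axis_ne_zero hG _) (dartVec_ne_zero hG o _) heq
    have hfalse := (o.ccwAngle_axis_eq_two_pi_iff hG).1 hsymm
    exact Bool.false_ne_true (hfalse.symm.trans h)
  have harg : arg (-(G.dartVec (e, false) / o.axis (e, false))) ≠ Real.pi := fun heq =>
    hne (by rw [ccwAngle, heq, two_mul])
  rw [ccwAngle, add_sub_cancel_right, ← (arg_inv _).trans (if_neg harg)]
  simp only [anglePlus, edgeVec, h, o.toBlack_succ, axis, axisDart, dartVec,
    Bool.false_eq_true, if_true, if_false]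
  rw [← neg_inv, inv_div, neg_div_neg_eq, neg_div]

lemma turn_eq {e : E} (h : o.toBlack e = true) :
    o.turn e = o.halfTurn (e, true) / o.halfTurn (e, false) := by
  rw [turn, o.angleMinus_eq h, o.anglePlus_eq hG h, halfTurn, halfTurn, halfAngle, halfAngle,
    ← Complex.exp_sub]
  push_cast
  ring_nf

lemma marking_eq (e : E) : o.marking e =
    o.dartSign (e, true) * (o.halfTurn (e, true) / o.halfTurn (e, false)) := by
  unfold marking dartSign
  split_ifs with h
  · rw [o.turn_eq hG h, one_mul]
  · rw [Bool.not_eq_true] at h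
    rw [o.halfTurn_of_toBlack_eq_false hG (d := (e, true)) h,
      o.halfTurn_of_toBlack_eq_false hG (d := (e, false)) h, div_self I_ne_zero, mul_one]

lemma dartFactor_marking (d : E × Bool) :
    dartFactor o.marking d = o.dartSign d * (o.halfTurn d / o.halfTurn (dartRev d)) := by
  rcases d with ⟨e, _ | _⟩
  · have hinv : (o.dartSign (e, true))⁻¹ = o.dartSign (e, false) :=
      inv_eq_of_mul_eq_one_left ((sq _).symm.trans (o.dartSign_sq _))
    simp only [dartFactor, dartRev, Bool.false_eq_true, if_false, Bool.not_false]
    rw [o.marking_eq hG, mul_inv, inv_div, hinv]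
  · exact o.marking_eq hG e

/-- The unit vector of the axis at the initial vertex of `d`, up to a sign depending on the colour
of that vertex: the squares of the dart factors are its quotients. -/
def direction (d : E × Bool) : ℂ := (if d.2 then 1 else -1) * (o.axis d / ‖o.axis d‖)

lemma direction_ne_zero (d : E × Bool) : o.direction d ≠ 0 := by
  have hne := o.axis_ne_zero hG d
  refine mul_ne_zero ?_ (div_ne_zero hne (by simpa using hne))
  split_ifs <;> norm_num

omit hG [Finite E] [DiscreteTopology Λ] in
lemma direction_congr {d d' : E × Bool} (h : G.dartSrc d = G.dartSrc d') :
    o.direction d = o.direction d' := by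
  rw [direction, direction, o.axis_congr h, snd_eq_of_dartSrc_eq h]

lemma halfTurn_sq (d : E × Bool) :
    o.halfTurn d ^ 2 = -(G.vec d.1 / ‖G.vec d.1‖) / o.direction d := by
  rw [halfTurn, halfAngle_sq (o.axis_ne_zero hG d) (dartVec_ne_zero hG o d), direction]
  rcases d with ⟨e, _ | _⟩
  · simp [dartVec, neg_div, div_neg]
  · simp [dartVec]

lemma dartFactor_marking_sq (d : E × Bool) :
    dartFactor o.marking d ^ 2 = o.direction (dartRev d) / o.direction d := by
  have hvec : G.vec d.1 ≠ 0 := dartVec_ne_zero hG o (d.1, true)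
  have hunit : -(G.vec d.1 / ‖G.vec d.1‖) ≠ 0 :=
    neg_ne_zero.2 (div_ne_zero hvec (by simpa using hvec))
  rw [o.dartFactor_marking hG, mul_pow, o.dartSign_sq, one_mul, div_pow, o.halfTurn_sq hG,
    o.halfTurn_sq hG]
  exact div_div_div_cancel_left' _ _ hunit

lemma prod_dartFactor_marking_sq {n : ℕ} {d : ℕ → E × Bool}
    (h : ∀ i < n, G.dartDst (d i) = G.dartSrc (d (i + 1))) :
    (∏ i ∈ Finset.range n, dartFactor o.marking (d i)) ^ 2 =
      o.direction (d n) / o.direction (d 0) := by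
  rw [← Finset.prod_pow]
  refine Finset.prod_range_induction _ (fun i => o.direction (d i) / o.direction (d 0))
    (div_self (o.direction_ne_zero hG _)) n fun i hi => ?_
  rw [o.dartFactor_marking_sq hG,
    o.direction_congr (d := dartRev (d i)) ((dartSrc_dartRev _).trans (h i hi)),
    div_mul_div_comm, mul_comm (o.direction (d i)),
    mul_div_mul_right _ _ (o.direction_ne_zero hG _)]

lemma halfTurn_div_halfTurn {x y : E × Bool} (hsrc : G.dartSrc y = G.dartSrc x)
    (hle : ∀ w, G.dartSrc w = G.dartSrc x →
      ccwAngle (G.dartVec y) (G.dartVec x) ≤ ccwAngle (G.dartVec y) (G.dartVec w)) :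
    o.halfTurn y / o.halfTurn x =
      exp (-(I / 2) * ccwAngle (G.dartVec y) (G.dartVec x)) * o.dartSign y := by
  have hout : ¬ccwAngle (G.dartVec y) (o.axis y) < ccwAngle (G.dartVec y) (G.dartVec x) :=
    not_lt.2 (hle _ ((o.dartSrc_axisDart y).trans hsrc))
  rw [halfTurn, halfTurn, ← o.axis_congr hsrc,
    halfAngle_div_halfAngle_eq_exp_ccwAngle (dartVec_ne_zero hG o y) (dartVec_ne_zero hG o x)
      (o.axis_ne_zero hG y), dartSign]
  simp only [hout, false_or, o.ccwAngle_axis_eq_two_pi_iff hG]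
  cases o.toBlack y.1 <;> simp

end Toric

section Next

variable {κ : ℂ} [Finite E] [DiscreteTopology Λ] (hG : G.IsToric) (hκ : κ ≠ 0)

lemma snd_next_liftedDrawing (d : E × Bool) : ((liftedDrawing hG o hκ).next d).2 = !d.2 :=
  snd_eq_of_dartSrc_eq ((liftedDrawing hG o hκ).src_next d)

lemma ccwAngle_next_dartRev_le {d w : E × Bool} (hw : G.dartSrc w = G.dartSrc (dartRev d)) :
    ccwAngle (G.dartVec ((liftedDrawing hG o hκ).next d)) (G.dartVec (dartRev d)) ≤
      ccwAngle (G.dartVec ((liftedDrawing hG o hκ).next d)) (G.dartVec w) := by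
  have hangle (y x : E × Bool) : ccwAngle ((liftedDrawing hG o hκ).vec y)
      ((liftedDrawing hG o hκ).vec x) = ccwAngle (G.dartVec y) (G.dartVec x) :=
    ccwAngle_div_div _ _ hκ
  have h := PlanarDrawing.ccwAngle_next_rev_le (P := liftedDrawing hG o hκ) hw
  rwa [hangle, hangle] at h

end Next

section Face

variable {κ : ℂ} [Finite E] [DiscreteTopology Λ] [IsZLattice ℝ Λ] (hG : G.IsToric)
  (hκ : G.IsGenericDirection κ) {f : Set (FlatTorus Λ)} (hf : G.IsFace f) {F : C(f, ℂ)}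
  (hF : ∀ x, torusCover Λ κ (F x) = x) {S : Finset (E × Bool)}
  (hS : (S : Set (E × Bool)) = (liftedFace hG o hκ hf hF).sides)

include hS

lemma card_sides_liftedFace : S.card = 2 * (S.filter fun d => d.2 = true).card := by
  have hflip : (S.filter fun d => ¬d.2 = true).card = (S.filter fun d => d.2 = true).card := by
    rw [Finset.card_filter, Finset.card_filter,
      ← PlanarRegion.sum_sides_next hS fun d => if d.2 = true then 1 else 0]
    refine Finset.sum_congr rfl fun d _ => ?_
    rw [show ((liftedFace hG o hκ hf hF).next d).2 = !d.2 from
      o.snd_next_liftedDrawing hG hκ.1 d]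
    cases d.2 <;> rfl
  rw [← S.card_filter_add_card_filter_not fun d => d.2 = true, hflip, two_mul]

theorem prod_dartFactor_marking_sides {m : ℕ} (hm : S.card = 2 * m) :
    ∏ d ∈ S, dartFactor o.marking d = (-1) ^ (m + 1) := by
  let R := liftedFace hG o hκ hf hF
  have hcorner (d : E × Bool) : o.halfTurn (R.next d) / o.halfTurn (dartRev d) =
      exp (-(I / 2) * ccwAngle (R.vec (R.next d)) (R.vec (R.rev d))) * o.dartSign (R.next d) := by
    rw [show ccwAngle (R.vec (R.next d)) (R.vec (R.rev d)) = _ from ccwAngle_div_div _ _ hκ.1]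
    exact o.halfTurn_div_halfTurn hG (R.src_next d) fun w hw =>
      o.ccwAngle_next_dartRev_le hG hκ.1 hw
  have hsign : (∏ d ∈ S, o.dartSign d) ^ 2 = 1 := by
    rw [← Finset.prod_pow]
    exact Finset.prod_eq_one fun d _ => o.dartSign_sq d
  calc ∏ d ∈ S, dartFactor o.marking d
      = (∏ d ∈ S, o.dartSign d) * ∏ d ∈ S, o.halfTurn (R.next d) / o.halfTurn (dartRev d) := by
        simp only [o.dartFactor_marking hG, Finset.prod_mul_distrib, Finset.prod_div_distrib,
          R, PlanarRegion.prod_sides_next hS o.halfTurn]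
    _ = (∏ d ∈ S, o.dartSign d) ^ 2 *
          ∏ d ∈ S, exp (-(I / 2) * ccwAngle (R.vec (R.next d)) (R.vec (R.rev d))) := by
        rw [Finset.prod_congr rfl fun d _ => hcorner d, Finset.prod_mul_distrib,
          PlanarRegion.prod_sides_next hS o.dartSign]
        ring
    _ = (-1) ^ (m + 1) := by
        rw [hsign, one_mul, PlanarRegion.prod_exp_ccwAngle_sides hS hm]

end Face

lemma exists_faceLength_eq_and_prod_faceBoundary [Fintype E] [DiscreteTopology Λ] [IsZLattice ℝ Λ]
    (hG : G.IsToric) {f : Set (FlatTorus Λ)} (hf : G.IsFace f) :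
    ∃ m : ℕ, G.faceLength f = 2 * m ∧
      ∏ d ∈ G.faceBoundary f, dartFactor o.marking d = (-1) ^ (m + 1) := by
  have : Finite (W ⊕ B) := Finite.of_surjective G.dartSrc (exists_dartSrc_eq o)
  obtain ⟨κ, hκ⟩ := exists_isGenericDirection (G := G)
  obtain ⟨F, hF⟩ := hf.exists_section hG o hκ.1
  have hS : (G.faceBoundary f : Set (E × Bool)) = (liftedFace hG o hκ hf hF).sides := by
    ext d
    rw [← liesLeftOf_iff_mem_sides_liftedFace, faceBoundary, Finset.coe_filter]
    simp
  have hm := o.card_sides_liftedFace hG hκ hf hF hS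
  exact ⟨_, hm, o.prod_dartFactor_marking_sides hG hκ hf hF hS hm⟩

end PerfectOrientation

end StraightGraph

end

theorem proposition3_general {Λ : Submodule ℤ ℂ} [DiscreteTopology Λ] [IsZLattice ℝ Λ]
    {W B E : Type*} [Fintype E] (G : StraightGraph Λ W B E) (hG : G.IsToric)
    (o : G.PerfectOrientation) : G.IsFractionalKasteleynMarking o.marking where
  ne_zero := o.marking_ne_zero
  face _ hf := o.exists_faceLength_eq_and_prod_faceBoundary hG hf
  cycle n d h := by
    rw [← sq_eq_one_iff, o.prod_dartFactor_marking_sq hG h.1, h.2,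
      div_self (o.direction_ne_zero hG _)]

theorem proposition3 {Λ : Submodule ℤ ℂ} [DiscreteTopology Λ] [IsZLattice ℝ Λ]
    {W B E : Type*} [Fintype E]
    (G : StraightGraph Λ W B E) (hG : G.IsToric) (hleaf : G.IsLeafless)
    (o : G.PerfectOrientation) :
    G.IsFractionalKasteleynMarking o.marking :=
  proposition3_general G hG o
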